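/- Let $a\in(-1,0)\cup(0,\infty)$, $\gamma_a:=a(1+a)$, and let $(x_a,z_a)$ be the solution on $\mathbb R$ of $$x''=(1+2\gamma_a)x-2x^3,\quad z'=x^2-\gamma_a,\quad x(0)=1+a,\ x'(0)=0,\ z(0)=0 .$$ Let $X_a(t,\theta)=(x_a(t)\cos\theta,\,x_a(t)\sin\theta,\,z_a(t))$ be the corresponding unduloid ($a<0$) or nodoid ($a>0$), $\mathbb S^1=\mathbb R/2\pi\mathbb Z$, and $N_a=\frac{\partial_tX_a\wedge\partial_\theta X_a}{|\partial_tX_a\wedge\partial_\theta X_a|}$. For an immersion $X$ of class $C^2$ of an interval times $\mathbb S^1$ into $\mathbb R^3$, with unit normal $N=\frac{X_t\wedge X_\theta}{|X_t\wedge X_\theta|}$, let $$\mathfrak M(X)=\frac{|X_t|^2\,(X_{\theta\theta}\cdot N)-2(X_t\cdot X_\theta)(X_{t\theta}\cdot N)+|X_\theta|^2\,(X_{tt}\cdot N)}{2\big(|X_t|^2|X_\theta|^2-(X_t\cdot X_\theta)^2\big)}$$ be its mean curvature, and let $$\mathfrak L_a\varphi:=\frac{\partial}{\partial s}\Big|_{s=0}\mathfrak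 M(X_a+s\varphi N_a)$$ be the Jacobi operator of $X_a$, for $\varphi$ of class $C^2$. Fix $\alpha\in(0,1)$ and, for $T>0$, let $$\mathcal X_T:=\{\varphi\in C^{2,\alpha}([-T,T]\times\mathbb S^1)\mid \varphi(\pm T,\cdot)=0,\ \varphi(-t,\cdot)=\varphi(t,\cdot)\ \forall t\in[-T,T]\},$$ and let $\ker(\mathfrak L_a)|_{\mathcal X_T}$ be the set of all $\varphi\in\mathcal X_T$ with $\mathfrak L_a\varphi=0$ in $[-T,T]\times\mathbb S^1$. For an integer $j\ge0$ let $\mathcal T_{a,j}$ be the set of all $T>0$ for which there is a nonzero $\varphi\in C^2(\mathbb R\times\mathbb S^1)$ of the form $\varphi(t,\theta)=w(t)\cos(j\theta)$, with $w$ even, such that $\mathfrak L_a\varphi=0$ on $\mathbb R\times\mathbb S^1$ and $\varphi(T,\cdot)=0$. Put $p_a:=x_a^2+\gamma_a^2/x_a^2$ and let $w_{a,j}$ be the solution on $\mathbb R$ of $$w''=(j^2-2p_a)w,\qquad w(0)=(-1)^{j+1},\quad w'(0)=0 .$$ Then, for every $T>0$, $\ker(\mathfrak L_a)|_{\mathcal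 X_T}$ is a finite-dimensional linear space, and $\ker(\mathfrak L_a)|_{\mathcal X_T}=\{0\}$ for every $T>0$ except for a countable set. More precisely, for every $T>0$: (i) If $a\in(-1,0)$, then $\ker(\mathfrak L_a)|_{\mathcal X_T}\ne\{0\}$ if and only if $T\in\mathcal T_{a,0}$, and in that case $\ker(\mathfrak L_a)|_{\mathcal X_T}=\mathrm{span}\{w_{a,0}(t)\}$. (ii) If $a\in\big(0,\tfrac12(\sqrt3-1)\big]$, then $\ker(\mathfrak L_a)|_{\mathcal X_T}\ne\{0\}$ if and only if $T\in\mathcal T_{a,0}\cup\mathcal T_{a,1}$, and in that case $$\ker(\mathfrak L_a)|_{\mathcal X_T}=\begin{cases}\mathrm{span}\{w_{a,0}(t)\}&\text{if }T\in\mathcal T_{a,0},\\ \mathrm{span}\{w_{a,1}(t)\cos\theta,\ w_{a,1}(t)\sin\theta\}&\text{if }T\in\mathcal T_{a,1}.\end{cases}$$ -/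

import Mathlib

open Set
open scoped NNReal

namespace Delaunay

/-! ### Delaunay profiles -/

/-- The constant `γ_a = a (1 + a)`. -/
def gam (a : ℝ) : ℝ := a * (1 + a)

/-- `(x, z)` solves, on the whole real line, the initial value problem
`x'' = (1 + 2 γ_a) x - 2 x³`, `z' = x² - γ_a`, `x(0) = 1 + a`, `x'(0) = 0`, `z(0) = 0`. -/
structure IsProfile (a : ℝ) (x z : ℝ → ℝ) : Prop where
  differentiable_x : Differentiable ℝ x
  hasDerivAt_deriv_x :
    ∀ t, HasDerivAt (deriv x) ((1 + 2 * gam a) * x t - 2 * x t ^ 3) t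
  hasDerivAt_z : ∀ t, HasDerivAt z (x t ^ 2 - gam a) t
  x_zero : x 0 = 1 + a
  deriv_x_zero : deriv x 0 = 0
  z_zero : z 0 = 0

/-- Global solution of the autonomous scalar equation `f' = ρ(f)`, `f(0) = 0`, for a continuous
positive bounded `ρ`. -/
theorem exists_amplitude (ρ : ℝ → ℝ) (hc : Continuous ρ) (hpos : ∀ y, 0 < ρ y) (B : ℝ)
    (hB : ∀ y, ρ y ≤ B) : ∃ f : ℝ → ℝ, f 0 = 0 ∧ ∀ t, HasDerivAt f (ρ (f t)) t := by
  have hBpos : 0 < B := (hpos 0).trans_le (hB 0)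
  have hinv : Continuous fun y => (ρ y)⁻¹ := hc.inv₀ fun y => (hpos y).ne'
  set F : ℝ → ℝ := fun y => ∫ s in (0 : ℝ)..y, (ρ s)⁻¹ with hF
  have hFd : ∀ y, HasDerivAt F (ρ y)⁻¹ y := fun y =>
    intervalIntegral.integral_hasDerivAt_right (hinv.intervalIntegrable _ _)
      hinv.aestronglyMeasurable.stronglyMeasurableAtFilter hinv.continuousAt
  have hF0 : F 0 = 0 := by simp [hF]
  have hFc : Continuous F := continuous_iff_continuousAt.2 fun y => (hFd y).continuousAt
  have hmono : StrictMono F := strictMono_of_deriv_pos fun y => by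
    rw [(hFd y).deriv]; exact inv_pos.2 (hpos y)
  -- `F y - y / B` is monotone, hence `F` is onto
  have hmono2 : Monotone fun y => F y - B⁻¹ * y := by
    have hd : ∀ y, HasDerivAt (fun y => F y - B⁻¹ * y) ((ρ y)⁻¹ - B⁻¹ * 1) y := fun y =>
      (hFd y).sub ((hasDerivAt_id y).const_mul _)
    refine monotone_of_deriv_nonneg (fun y => (hd y).differentiableAt) fun y => ?_
    rw [(hd y).deriv, mul_one, sub_nonneg]
    exact inv_anti₀ (hpos y) (hB y)
  have hsurj : Function.Surjective F := by
    intro c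
    have h1 : F (-(B * |c|)) ≤ c := by
      have := hmono2 (show -(B * |c|) ≤ 0 by
        have := mul_nonneg hBpos.le (abs_nonneg c); linarith)
      simp only [hF0, mul_zero, sub_zero] at this
      have e : B⁻¹ * -(B * |c|) = -|c| := by field_simp
      have := neg_abs_le c
      linarith
    have h2 : c ≤ F (B * |c|) := by
      have := hmono2 (show 0 ≤ B * |c| from mul_nonneg hBpos.le (abs_nonneg c))
      simp only [hF0, mul_zero, sub_zero] at this
      have e : B⁻¹ * (B * |c|) = |c| := by field_simp
      have := le_abs_self c
      linarith
    exact mem_range_of_exists_le_of_exists_ge hFc ⟨_, h1⟩ ⟨_, h2⟩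
  set e := hmono.orderIsoOfSurjective F hsurj with he
  have hFe : ∀ t, F (e.symm t) = t := fun t => e.apply_symm_apply t
  refine ⟨e.symm, hmono.injective (by rw [hFe, hF0]), fun t => ?_⟩
  have := HasDerivAt.of_local_left_inverse (f := F) (g := e.symm) (a := t)
    e.symm.continuous.continuousAt (hFd _) (inv_pos.2 (hpos _)).ne'
    (Filter.Eventually.of_forall hFe)
  simpa using this

/-- The initial value problem has a global solution for every admissible Delaunay parameter. -/
theorem exists_isProfile {a : ℝ} (ha : a ∈ Ioo (-1) 0 ∪ Ioi 0) :
    ∃ P : (ℝ → ℝ) × (ℝ → ℝ), IsProfile a P.1 P.2 := by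
  have ha0 : a ≠ 0 := by
    rcases ha with h | h
    · exact h.2.ne
    · exact (mem_Ioi.1 h).ne'
  have hm : 0 < 1 + a := by
    rcases ha with h | h
    · linarith [h.1]
    · linarith [mem_Ioi.1 h]
  set h : ℝ → ℝ := fun y => (1 + a) ^ 2 * Real.cos y ^ 2 + a ^ 2 * Real.sin y ^ 2 with hh
  have hpos : ∀ y, 0 < h y := fun y => by
    have h1 := Real.sin_sq_add_cos_sq y
    have h2 : 0 < (1 + a) ^ 2 := by positivity
    have h3 : 0 < a ^ 2 := by positivity
    simp only [hh]
    rcases (sq_nonneg (Real.cos y)).eq_or_lt with h4 | h4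
    · have h5 : Real.sin y ^ 2 = 1 := by linarith
      rw [← h4, h5]; linarith
    · have h5 := mul_pos h2 h4
      have h6 := mul_nonneg h3.le (sq_nonneg (Real.sin y))
      linarith
  have hcont : Continuous h := by fun_prop
  obtain ⟨f, hf0, hf⟩ := exists_amplitude (fun y => Real.sqrt (h y)) hcont.sqrt
    (fun y => Real.sqrt_pos.2 (hpos y)) (Real.sqrt ((1 + a) ^ 2 + a ^ 2)) (fun y => by
      refine Real.sqrt_le_sqrt ?_
      have h1 := Real.cos_sq_le_one y
      have h2 := Real.sin_sq_le_one y
      have h3 := mul_le_mul_of_nonneg_left h1 (sq_nonneg (1 + a))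
      have h4 := mul_le_mul_of_nonneg_left h2 (sq_nonneg a)
      simp only [hh]
      linarith)
  set x : ℝ → ℝ := fun t => Real.sqrt (h (f t)) with hx
  have hxpos : ∀ t, 0 < x t := fun t => Real.sqrt_pos.2 (hpos _)
  have hxsq : ∀ t, x t ^ 2 = h (f t) := fun t => Real.sq_sqrt (hpos _).le
  have hs : ∀ t, HasDerivAt (fun t => Real.sin (f t)) (Real.cos (f t) * x t) t :=
    fun t => (hf t).sin
  have hc : ∀ t, HasDerivAt (fun t => Real.cos (f t)) (-Real.sin (f t) * x t) t :=
    fun t => (hf t).cos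
  have hxd : ∀ t, HasDerivAt x
      ((a ^ 2 - (1 + a) ^ 2) * (Real.sin (f t) * Real.cos (f t))) t := fun t => by
    have h1 : HasDerivAt (fun t => h (f t))
        ((1 + a) ^ 2 * (2 * Real.cos (f t) * (-Real.sin (f t) * x t))
          + a ^ 2 * (2 * Real.sin (f t) * (Real.cos (f t) * x t))) t := by
      have e1 := ((hc t).pow 2).const_mul ((1 + a) ^ 2)
      have e2 := ((hs t).pow 2).const_mul (a ^ 2)
      convert! e1.add e2 using 1
      norm_num
    convert! h1.sqrt (hpos _).ne' using 1
    have := (hxpos t).ne'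
    change _ = _ / (2 * x t)
    field_simp
    ring
  have hxd' : deriv x = fun t => (a ^ 2 - (1 + a) ^ 2) * (Real.sin (f t) * Real.cos (f t)) :=
    funext fun t => (hxd t).deriv
  have hxcont : Continuous x := continuous_iff_continuousAt.2 fun t => (hxd t).continuousAt
  refine ⟨⟨x, fun t => ∫ s in (0 : ℝ)..t, (x s ^ 2 - gam a)⟩, ?_⟩
  refine ⟨fun t => (hxd t).differentiableAt, fun t => ?_, fun t => ?_, ?_, ?_, ?_⟩
  · simp only [hxd']
    convert! ((hs t).mul (hc t)).const_mul (a ^ 2 - (1 + a) ^ 2) using 1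
    have e1 := hxsq t
    have e2 := Real.sin_sq_add_cos_sq (f t)
    have e3 : x t ^ 3 = x t * ((1 + a) ^ 2 * Real.cos (f t) ^ 2 + a ^ 2 * Real.sin (f t) ^ 2) := by
      rw [pow_succ, e1]; ring
    have e4 : Real.cos (f t) ^ 2 = 1 - Real.sin (f t) ^ 2 := by linarith
    rw [e3, gam]
    linear_combination (-(2 * (1 + a) ^ 2) - (a ^ 2 - (1 + a) ^ 2)) * x t * e4
  · have hcz : Continuous fun s => x s ^ 2 - gam a := by fun_prop
    exact intervalIntegral.integral_hasDerivAt_right (hcz.intervalIntegrable _ _)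
      hcz.aestronglyMeasurable.stronglyMeasurableAtFilter hcz.continuousAt
  · simp [hx, hf0, hh, Real.sqrt_sq hm.le]
  · simp [hxd', hf0]
  · simp

/-- The pair `(x_a, z_a)`: the solution of the initial value problem of `IsProfile`. -/
noncomputable def profile (a : ℝ) : (ℝ → ℝ) × (ℝ → ℝ) :=
  Classical.epsilon fun P : (ℝ → ℝ) × (ℝ → ℝ) => IsProfile a P.1 P.2

/-- The radius function `x_a`. -/
noncomputable def xa (a : ℝ) : ℝ → ℝ := (profile a).1

/-- The height function `z_a`. -/
noncomputable def za (a : ℝ) : ℝ → ℝ := (profile a).2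

theorem isProfile {a : ℝ} (ha : a ∈ Ioo (-1) 0 ∪ Ioi 0) : IsProfile a (xa a) (za a) :=
  Classical.epsilon_spec (exists_isProfile ha)

/-- The unduloid (`-1 < a < 0`) or nodoid (`0 < a`)
`X_a(t, θ) = (x_a(t) cos θ, x_a(t) sin θ, z_a(t))`. -/
noncomputable def surf (a t θ : ℝ) : Fin 3 → ℝ :=
  ![xa a t * Real.cos θ, xa a t * Real.sin θ, za a t]

/-! ### Mean curvature of annular surfaces and the Jacobi operator

Maps on `I × 𝕊¹`, with `I` an interval, are written as maps of two real variables `(t, θ)` with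
`t ∈ I`, periodic of period `2π` in `θ`. Derivatives in `t` are taken relative to `I`, that is,
they are one-sided at an endpoint of `I`. -/

section Curvature

variable {E : Type*} [NormedAddCommGroup E] [NormedSpace ℝ E]

/-- `∂X/∂t` on `I × 𝕊¹`. -/
noncomputable def dt (I : Set ℝ) (X : ℝ → ℝ → E) (t θ : ℝ) : E :=
  derivWithin (fun s => X s θ) I t

/-- `∂X/∂θ`. -/
noncomputable def dth (X : ℝ → ℝ → E) (t θ : ℝ) : E :=
  deriv (fun η => X t η) θ

end Curvature

/-- The unit normal `N = X_t ∧ X_θ / |X_t ∧ X_θ|`. -/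
noncomputable def normal (I : Set ℝ) (X : ℝ → ℝ → Fin 3 → ℝ) (t θ : ℝ) : Fin 3 → ℝ :=
  let v := crossProduct (dt I X t θ) (dth X t θ)
  (Real.sqrt (v ⬝ᵥ v))⁻¹ • v

/-- The mean curvature `𝔐(X) = (E N - 2 F M + G L) / (2 (E G - F²))`, in terms of the coefficients
of the first and second fundamental forms. -/
noncomputable def meanCurv (I : Set ℝ) (X : ℝ → ℝ → Fin 3 → ℝ) (t θ : ℝ) : ℝ :=
  let e := dt I X t θ ⬝ᵥ dt I X t θ
  let f := dt I X t θ ⬝ᵥ dth X t θ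
  let g := dth X t θ ⬝ᵥ dth X t θ
  let l := dt I (dt I X) t θ ⬝ᵥ normal I X t θ
  let m := dth (dt I X) t θ ⬝ᵥ normal I X t θ
  let n := dth (dth X) t θ ⬝ᵥ normal I X t θ
  (e * n - 2 * f * m + g * l) / (2 * (e * g - f ^ 2))

/-- The Jacobi operator of `X_a` on `I × 𝕊¹`,
`𝔏_a φ = ∂/∂s 𝔐(X_a + s φ N_a)` at `s = 0`, where `N_a` is the unit normal of `X_a`. -/
noncomputable def jacobi (a : ℝ) (I : Set ℝ) (φ : ℝ → ℝ → ℝ) (t θ : ℝ) : ℝ :=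
  deriv (fun s : ℝ =>
    meanCurv I (fun t' θ' => surf a t' θ' + (s * φ t' θ') • normal I (surf a) t' θ') t θ) 0

/-! ### The function space and the kernel -/

open Classical in
/-- A function on `I × 𝕊¹`, with `𝕊¹ = ℝ / 2πℤ`, as a function of two real variables that is
`2π`-periodic in `θ`; the value for `t ∉ I` is irrelevant and set to `0`. -/
noncomputable def lift {I : Set ℝ} (φ : I × Real.Angle → ℝ) (t θ : ℝ) : ℝ :=
  if h : t ∈ I then φ (⟨t, h⟩, (θ : Real.Angle)) else 0

/-- `φ ∈ C^{2,α}(I × 𝕊¹)`: `φ` is of class `C²` (up to the boundary) and its second derivatives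
are Hölder continuous with exponent `α`. -/
def IsC2Holder (α : ℝ≥0) {I : Set ℝ} (φ : I × Real.Angle → ℝ) : Prop :=
  ContDiffOn ℝ 2 (fun p : ℝ × ℝ => lift φ p.1 p.2) (I ×ˢ univ) ∧
  ∃ C : ℝ≥0, HolderOnWith C α
    (iteratedFDerivWithin ℝ 2 (fun p : ℝ × ℝ => lift φ p.1 p.2) (I ×ˢ univ)) (I ×ˢ univ)

/-- The space `𝒳_T` of functions in `C^{2,α}([-T,T] × 𝕊¹)` that vanish for `t = ± T` and are even
in `t`. -/
def XT (α : ℝ≥0) (T : ℝ) : Set (Icc (-T) T × Real.Angle → ℝ) :=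
  {φ | IsC2Holder α φ ∧ (∀ θ : ℝ, lift φ T θ = 0 ∧ lift φ (-T) θ = 0) ∧
    ∀ t ∈ Icc (-T) T, ∀ θ : ℝ, lift φ (-t) θ = lift φ t θ}

/-- The kernel of `𝔏_a` in `𝒳_T`: all `φ ∈ 𝒳_T` with `𝔏_a φ = 0` in `[-T,T] × 𝕊¹`. -/
def jacobiKer (a : ℝ) (α : ℝ≥0) (T : ℝ) : Set (Icc (-T) T × Real.Angle → ℝ) :=
  {φ | φ ∈ XT α T ∧ ∀ t ∈ Icc (-T) T, ∀ θ : ℝ, jacobi a (Icc (-T) T) (lift φ) t θ = 0}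

/-- The set `𝒯_{a,j}` of all `T > 0` such that some nonzero `φ ∈ C²(ℝ × 𝕊¹)` of the form
`φ(t, θ) = w(t) cos(jθ)`, with `w` even, satisfies `𝔏_a φ = 0` on `ℝ × 𝕊¹` and `φ(T, ·) = 0`. -/
def nodalTimes (a : ℝ) (j : ℕ) : Set ℝ :=
  {T | 0 < T ∧ ∃ (w : ℝ → ℝ) (φ : ℝ → ℝ → ℝ), (∀ t, w (-t) = w t) ∧
    (∀ t θ, φ t θ = w t * Real.cos (j * θ)) ∧
    ContDiff ℝ 2 (fun p : ℝ × ℝ => φ p.1 p.2) ∧ φ ≠ 0 ∧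
    (∀ t θ, jacobi a univ φ t θ = 0) ∧ ∀ θ, φ T θ = 0}

/-! ### The functions `w_{a,0}` and `w_{a,1}` -/

/-- The potential `p_a = x_a² + γ_a² / x_a²`. -/
noncomputable def pa (a t : ℝ) : ℝ := xa a t ^ 2 + gam a ^ 2 / xa a t ^ 2

/-- `u` solves the Cauchy problem `u'' = (j² - 2 p_a) u` in `ℝ`, `u(0) = (-1)^(j+1)`,
`u'(0) = 0`. -/
structure IsEvenSol (a : ℝ) (j : ℕ) (u : ℝ → ℝ) : Prop where
  differentiable : Differentiable ℝ u
  hasDerivAt_deriv : ∀ t, HasDerivAt (deriv u) (((j : ℝ) ^ 2 - 2 * pa a t) * u t) t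
  zero : u 0 = (-1) ^ (j + 1)
  deriv_zero : deriv u 0 = 0

theorem IsProfile.conservation {a : ℝ} {x z : ℝ → ℝ} (h : IsProfile a x z) (t : ℝ) :
    deriv x t ^ 2 = (1 + 2 * gam a) * x t ^ 2 - x t ^ 4 - gam a ^ 2 := by
  have hx : ∀ t, HasDerivAt x (deriv x t) t := fun t => (h.differentiable_x t).hasDerivAt
  have hd : ∀ t, HasDerivAt
      (fun t => deriv x t ^ 2 - (1 + 2 * gam a) * x t ^ 2 + x t ^ 4) 0 t := fun t => by
    have e1 := (h.hasDerivAt_deriv_x t).pow 2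
    have e2 := ((hx t).pow 2).const_mul (1 + 2 * gam a)
    have e3 := (hx t).pow 4
    convert! (e1.sub e2).add e3 using 1
    norm_num
    ring
  have hconst := is_const_of_deriv_eq_zero (fun t => (hd t).differentiableAt)
    (fun t => (hd t).deriv) t 0
  simp only [h.deriv_x_zero, h.x_zero] at hconst
  have : gam a = a * (1 + a) := rfl
  rw [this] at hconst ⊢
  linear_combination hconst

theorem IsProfile.x_pos {a : ℝ} (ha : a ∈ Ioo (-1) 0 ∪ Ioi 0) {x z : ℝ → ℝ}
    (h : IsProfile a x z) (t : ℝ) : 0 < x t := by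
  have ha0 : a ≠ 0 := by
    rcases ha with h | h
    · exact h.2.ne
    · exact (mem_Ioi.1 h).ne'
  have hm : 0 < 1 + a := by
    rcases ha with h | h
    · linarith [h.1]
    · linarith [mem_Ioi.1 h]
  have hne : ∀ s, x s ≠ 0 := fun s hs => by
    have := h.conservation s
    rw [hs] at this
    have h2 : 0 < gam a ^ 2 := by
      have : gam a ≠ 0 := mul_ne_zero ha0 hm.ne'
      positivity
    nlinarith [sq_nonneg (deriv x s)]
  by_contra hneg
  have h0 : 0 ≤ x 0 := by rw [h.x_zero]; exact hm.le
  obtain ⟨s, hs⟩ := mem_range_of_exists_le_of_exists_ge h.differentiable_x.continuous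
    ⟨t, not_lt.1 hneg⟩ ⟨0, h0⟩
  exact hne s hs

theorem exists_isEvenSol_one {a : ℝ} (ha : a ∈ Ioo (-1) 0 ∪ Ioi 0) :
    ∃ u, IsEvenSol a 1 u := by
  have h := isProfile ha
  set x := xa a with hxdef
  have hx : ∀ t, HasDerivAt x (deriv x t) t := fun t => (h.differentiable_x t).hasDerivAt
  have hne : ∀ t, x t ≠ 0 := fun t => (h.x_pos ha t).ne'
  have hu : ∀ t, HasDerivAt (fun t => x t - gam a * (x t)⁻¹)
      (deriv x t * (1 + gam a / x t ^ 2)) t := fun t => by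
    convert! (hx t).sub (((hx t).inv (hne t)).const_mul (gam a)) using 1
    have := hne t
    field_simp
    ring
  have hu' : deriv (fun t => x t - gam a * (x t)⁻¹) =
      fun t => deriv x t * (1 + gam a / x t ^ 2) := funext fun t => (hu t).deriv
  refine ⟨_, fun t => (hu t).differentiableAt, fun t => ?_, ?_, ?_⟩
  · rw [hu']
    have e1 := (((hx t).pow 2).inv (pow_ne_zero 2 (hne t))).const_mul (gam a)
    have e2 := (h.hasDerivAt_deriv_x t).mul (e1.const_add 1)
    convert! e2 using 1
    have hc := h.conservation t
    have := hne t
    simp only [pa, ← hxdef]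
    norm_num
    field_simp
    linear_combination (2 * gam a) * hc
  · have : 1 + a ≠ 0 := h.x_zero ▸ hne 0
    simp only [h.x_zero, gam]
    field_simp
    ring
  · rw [hu']
    simp [h.deriv_x_zero]

theorem exists_isEvenSol_zero {a : ℝ} (ha : a ∈ Ioo (-1) 0 ∪ Ioi 0) :
    ∃ u, IsEvenSol a 0 u := by
  have h := isProfile ha
  set x := xa a with hxdef
  set z := za a with hzdef
  have hx : ∀ t, HasDerivAt x (deriv x t) t := fun t => (h.differentiable_x t).hasDerivAt
  have hne : ∀ t, x t ≠ 0 := fun t => (h.x_pos ha t).ne'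
  by_cases hhalf : 1 + 2 * a = 0
  · -- the cylinder
    have ha' : a = -1 / 2 := by linarith
    have hxc : ∀ t, x t ^ 2 = 1 / 4 := fun t => by
      have hc := h.conservation t
      have hg : gam a = -1 / 4 := by rw [gam, ha']; norm_num
      rw [hg] at hc
      have h1 : (x t ^ 2 - 1 / 4) ^ 2 ≤ 0 := by nlinarith [sq_nonneg (deriv x t)]
      have h2 : x t ^ 2 - 1 / 4 = 0 := by
        have := le_antisymm h1 (sq_nonneg _)
        exact pow_eq_zero_iff (two_ne_zero) |>.1 this
      linarith
    have hu : ∀ t, HasDerivAt (fun t => -Real.cos t) (Real.sin t) t := fun t => by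
      convert! (Real.hasDerivAt_cos t).neg using 1
      ring
    have hu' : deriv (fun t => -Real.cos t) = Real.sin := funext fun t => (hu t).deriv
    refine ⟨fun t => -Real.cos t, fun t => (hu t).differentiableAt, fun t => ?_, ?_, ?_⟩
    · rw [hu']
      convert! Real.hasDerivAt_sin t using 1
      have hg : gam a = -1 / 4 := by rw [gam, ha']; norm_num
      simp only [pa, ← hxdef, hxc, hg]
      norm_num
    · simp
    · rw [hu']; simp
  · set u : ℝ → ℝ := fun t =>
      (1 + 2 * a)⁻¹ * (1 + 2 * gam a - 2 * x t ^ 2 + deriv x t * (x t)⁻¹ * (2 * z t - t)) with hudef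
    have hr : ∀ t, HasDerivAt (fun t => deriv x t * (x t)⁻¹) (gam a ^ 2 / x t ^ 2 - x t ^ 2) t :=
      fun t => by
        convert! (h.hasDerivAt_deriv_x t).mul ((hx t).inv (hne t)) using 1
        have hc := h.conservation t
        have := hne t
        simp only [Pi.inv_apply]
        field_simp
        linear_combination hc
    have hz : ∀ t, HasDerivAt (fun t => 2 * z t - t) (2 * (x t ^ 2 - gam a) - 1) t := fun t =>
      ((h.hasDerivAt_z t).const_mul 2).sub (hasDerivAt_id t)
    have hu : ∀ t, HasDerivAt u ((1 + 2 * a)⁻¹ *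
        ((gam a ^ 2 / x t ^ 2 - x t ^ 2) * (2 * z t - t)
          - (1 + 2 * gam a + 2 * x t ^ 2) * (deriv x t * (x t)⁻¹))) t := fun t => by
      have e1 := (((hx t).pow 2).const_mul 2).const_sub (1 + 2 * gam a)
      have e2 := (e1.add ((hr t).mul (hz t))).const_mul (1 + 2 * a)⁻¹
      convert! e2 using 1
      have := hne t
      norm_num
      field_simp
      ring_nf
      simp
    have hu' := funext fun t => (hu t).deriv
    refine ⟨u, fun t => (hu t).differentiableAt, fun t => ?_, ?_, ?_⟩
    · rw [show deriv u = _ from hu']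
      have e1 := (((hx t).pow 2).inv (pow_ne_zero 2 (hne t))).const_mul (gam a ^ 2)
      have e2 := (e1.sub ((hx t).pow 2)).mul (hz t)
      have e3 := ((((hx t).pow 2).const_mul 2).const_add (1 + 2 * gam a)).mul (hr t)
      have e4 := (e2.sub e3).const_mul (1 + 2 * a)⁻¹
      convert! e4 using 1
      have hc := h.conservation t
      have := hne t
      simp only [pa, ← hxdef, hudef]
      norm_num
      field_simp
      linear_combination (4 * x t ^ 3) * hc
    · simp only [hudef, h.x_zero, h.deriv_x_zero, gam]
      field_simp
      ring
    · rw [show deriv u = _ from hu']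
      simp [h.deriv_x_zero, h.z_zero]

/-- The function `w_{a,j}`: the solution of the Cauchy problem of `IsEvenSol`. -/
noncomputable def wa (a : ℝ) (j : ℕ) : ℝ → ℝ :=
  Classical.epsilon (IsEvenSol a j)

theorem isEvenSol_wa_zero {a : ℝ} (ha : a ∈ Ioo (-1) 0 ∪ Ioi 0) : IsEvenSol a 0 (wa a 0) :=
  Classical.epsilon_spec (exists_isEvenSol_zero ha)

theorem isEvenSol_wa_one {a : ℝ} (ha : a ∈ Ioo (-1) 0 ∪ Ioi 0) : IsEvenSol a 1 (wa a 1) :=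
  Classical.epsilon_spec (exists_isEvenSol_one ha)

end Delaunay

open scoped Topology

/-!
The Delaunay immersion `X_a` is conformal, `|∂_t X_a|² = |∂_θ X_a|² = x_a²`, and its unit normal is
`(-z'/x, 0, x'/x)` in cylindrical coordinates. Differentiating the mean curvature of
`X_a + s φ N_a` at `s = 0` gives the Jacobi operator in closed form,
`𝔏_a φ = (φ_tt + φ_θθ + 2 p_a φ) / (2 x_a²)` (`jacobi_eq`; the algebra is in
`hasDerivAt_polarMeanCurv`). The coefficients do not depend on `θ`, so for `φ` in the kernel each
Fourier coefficient of `φ(t, ·)` of order `j` is an even solution of `f'' = (j² - 2 p_a) f` on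
`[-T, T]` that vanishes at the ends, a *mode* (`exists_isMode`). An even solution is determined by
its value at `0`, and a continuous function on the circle by its Fourier coefficients, so `φ` is
determined by the Fourier coefficients of `φ(0, ·)` (`eq_zero_of_angularCoeff`).

Which modes occur is decided by a Picone comparison (`eq_zero_of_positive_solution`): there are none
of order `j` if `w'' = q w` has a positive solution for some `q ≤ j² - 2 p_a`. As
`p_a = 1 + 2 γ_a - (x'/x)² ≤ 1 + 2 γ_a`, the choice `w = 1`, `q = 0` excludes all `j` with
`j² ≥ 2 (1 + 2 γ_a)`. So the kernel is finite-dimensional; if `γ_a ≤ 1/2`, that is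
`a ≤ (√3 - 1)/2`, only `j = 0, 1` remain. For `a < 0` the function `w_{a,1} = x - γ_a / x` is
positive and excludes all `j ≥ 1`. For fixed `j` the mode on a large interval vanishes at all
smaller admissible `T`, and its zeros are simple; so these `T` form a countable set
(`countable_modeTimes`).

When `T` is a zero of `w_{a,0}` or `w_{a,1}`, the functions in the statement lie in the kernel, and
they span it because the other modes vanish. For `a > 0` this needs that `w_{a,0}` and `w_{a,1}`
have no common positive zero (`wa_one_ne_zero`). It follows from the explicit formula for `w_{a,0}`
and the monotonicity of `2 z - t + x'/x`, whose derivative is `-(x'/x)²`.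
-/

namespace Delaunay

/-! ### Linear second order equations -/

/-- Uniqueness for `f'' = q f` with bounded `q`, the Cauchy data being prescribed at `t₀`. -/
theorem linear_ode_unique {q : ℝ → ℝ} {K c d t₀ : ℝ} (hK : ∀ t, |q t| ≤ K) (ht₀ : t₀ ∈ Ioo c d)
    {f f' g g' : ℝ → ℝ} (hf : ∀ t ∈ Ioo c d, HasDerivAt f (f' t) t)
    (hf' : ∀ t ∈ Ioo c d, HasDerivAt f' (q t * f t) t)
    (hg : ∀ t ∈ Ioo c d, HasDerivAt g (g' t) t)
    (hg' : ∀ t ∈ Ioo c d, HasDerivAt g' (q t * g t) t)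
    (h0 : f t₀ = g t₀) (h1 : f' t₀ = g' t₀) : EqOn f g (Ioo c d) := by
  have key := ODE_solution_unique_of_mem_Ioo (E := ℝ × ℝ) (K := (max 1 K).toNNReal)
    (v := fun t p => (p.2, q t * p.1)) (s := fun _ => univ) (t₀ := t₀) (a := c) (b := d)
    (f := fun t => (f t, f' t)) (g := fun t => (g t, g' t)) ?_ ht₀
    (fun t ht => ⟨(hf t ht).prodMk (hf' t ht), mem_univ _⟩)
    (fun t ht => ⟨(hg t ht).prodMk (hg' t ht), mem_univ _⟩) (by simp [h0, h1])
  · intro t ht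
    exact congrArg Prod.fst (key ht)
  · intro t _
    refine LipschitzWith.lipschitzOnWith (LipschitzWith.of_dist_le_mul fun u v => ?_)
    have hm : (0 : ℝ) ≤ max 1 K := le_max_of_le_left zero_le_one
    rw [Real.coe_toNNReal _ hm, Prod.dist_eq, Prod.dist_eq, Real.dist_eq, Real.dist_eq,
      Real.dist_eq]
    have hu1 := le_max_left |u.1 - v.1| |u.2 - v.2|
    have hu2 := le_max_right |u.1 - v.1| |u.2 - v.2|
    refine max_le ?_ ?_
    · exact hu2.trans (le_mul_of_one_le_left ((abs_nonneg _).trans hu1) (le_max_left _ _))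
    · change |q t * u.1 - q t * v.1| ≤ _
      rw [← mul_sub, abs_mul]
      exact mul_le_mul ((hK t).trans (le_max_right _ _)) hu1 (abs_nonneg _) hm

/-- A Picone type comparison: if `w'' = q w` has a positive solution on `[-T, T]` and `Q ≥ q`,
then a solution of `f'' = Q f` that vanishes at both ends is zero. With `W = f' w - f w'`, the
function `(f / w) W` is monotone, since its derivative is `(W / w)² + (Q - q) f²`, and it vanishes
at both ends; so `W = 0` and `f / w` is constant. -/
theorem eq_zero_of_positive_solution {T : ℝ} (hT : 0 < T) {q Q w w' f g : ℝ → ℝ}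
    (hwpos : ∀ t ∈ Icc (-T) T, 0 < w t) (hw'c : ContinuousOn w' (Icc (-T) T))
    (hwc : ContinuousOn w (Icc (-T) T))
    (hw : ∀ t ∈ Ioo (-T) T, HasDerivAt w (w' t) t)
    (hw' : ∀ t ∈ Ioo (-T) T, HasDerivAt w' (q t * w t) t)
    (hfc : ContinuousOn f (Icc (-T) T)) (hgc : ContinuousOn g (Icc (-T) T))
    (hf : ∀ t ∈ Ioo (-T) T, HasDerivAt f (g t) t)
    (hg : ∀ t ∈ Ioo (-T) T, HasDerivAt g (Q t * f t) t)
    (hqQ : ∀ t ∈ Ioo (-T) T, q t ≤ Q t) (h0 : f (-T) = 0) (h1 : f T = 0) :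
    ∀ t ∈ Icc (-T) T, f t = 0 := by
  have hTT : -T ≤ T := by linarith
  have hint : interior (Icc (-T) T) = Ioo (-T) T := interior_Icc
  have hd : ∀ t ∈ Ioo (-T) T, HasDerivAt (fun t => f t / w t * (g t * w t - f t * w' t))
      (((g t * w t - f t * w' t) / w t) ^ 2 + (Q t - q t) * f t ^ 2) t := fun t ht => by
    have hne := (hwpos t (Ioo_subset_Icc_self ht)).ne'
    convert! ((hf t ht).div (hw t ht) hne).mul
      (((hg t ht).mul (hw t ht)).sub ((hf t ht).mul (hw' t ht))) using 1
    simp only [Pi.div_apply, Pi.sub_apply, Pi.mul_apply]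
    field_simp
    ring
  have hcont : ContinuousOn (fun t => f t / w t * (g t * w t - f t * w' t)) (Icc (-T) T) :=
    (hfc.div hwc fun t ht => (hwpos t ht).ne').mul ((hgc.mul hwc).sub (hfc.mul hw'c))
  have hmono : MonotoneOn (fun t => f t / w t * (g t * w t - f t * w' t)) (Icc (-T) T) := by
    refine monotoneOn_of_deriv_nonneg (convex_Icc _ _) hcont ?_ ?_
    · rw [hint]; exact fun t ht => (hd t ht).differentiableAt.differentiableWithinAt
    · rw [hint]; intro t ht
      rw [(hd t ht).deriv]
      have := mul_nonneg (sub_nonneg.2 (hqQ t ht)) (sq_nonneg (f t))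
      positivity
  have hzero : ∀ t ∈ Icc (-T) T, f t / w t * (g t * w t - f t * w' t) = 0 := fun t ht => by
    have e1 := hmono (left_mem_Icc.2 hTT) ht ht.1
    have e2 := hmono ht (right_mem_Icc.2 hTT) ht.2
    simp only [h0, h1, zero_div, zero_mul] at e1 e2
    exact le_antisymm e2 e1
  have hW : ∀ t ∈ Ioo (-T) T, g t * w t - f t * w' t = 0 := fun t ht => by
    have e1 : HasDerivAt (fun t => f t / w t * (g t * w t - f t * w' t)) 0 t :=
      (hasDerivAt_const t (0 : ℝ)).congr_of_eventuallyEq (by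
        filter_upwards [Ioo_mem_nhds ht.1 ht.2] with s hs
        exact hzero s (Ioo_subset_Icc_self hs))
    have e2 := (hd t ht).unique e1
    have e3 := mul_nonneg (sub_nonneg.2 (hqQ t ht)) (sq_nonneg (f t))
    have e4 : ((g t * w t - f t * w' t) / w t) ^ 2 = 0 :=
      le_antisymm (by linarith) (sq_nonneg _)
    have e5 := pow_eq_zero_iff (two_ne_zero) |>.1 e4
    rcases div_eq_zero_iff.1 e5 with h | h
    · exact h
    · exact absurd h (hwpos t (Ioo_subset_Icc_self ht)).ne'
  have hquot : ∀ t ∈ Ioo (-T) T, HasDerivAt (fun t => f t / w t) 0 t := fun t ht => by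
    convert! (hf t ht).div (hw t ht) (hwpos t (Ioo_subset_Icc_self ht)).ne' using 1
    rw [hW t ht, zero_div]
  intro t ht
  have hanti : AntitoneOn (fun t => f t / w t) (Icc (-T) T) := by
    refine antitoneOn_of_deriv_nonpos (convex_Icc _ _)
      (hfc.div hwc fun t ht => (hwpos t ht).ne') ?_ ?_
    · rw [hint]; exact fun t ht => (hquot t ht).differentiableAt.differentiableWithinAt
    · rw [hint]; exact fun t ht => (hquot t ht).deriv.le
  have e1 := hanti (left_mem_Icc.2 hTT) ht ht.1
  have e2 := hanti ht (right_mem_Icc.2 hTT) ht.2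
  simp only [h0, h1, zero_div] at e1 e2
  rcases div_eq_zero_iff.1 (le_antisymm e1 e2) with h | h
  · exact h
  · exact absurd h (hwpos t ht).ne'

/-! ### The profile curve -/

section Profile

variable {a : ℝ}

theorem one_add_pos (ha : a ∈ Ioo (-1) 0 ∪ Ioi 0) : 0 < 1 + a := by
  rcases ha with h | h
  · linarith [h.1]
  · linarith [mem_Ioi.1 h]

theorem xa_pos (ha : a ∈ Ioo (-1) 0 ∪ Ioi 0) (t : ℝ) : 0 < xa a t := (isProfile ha).x_pos ha t

theorem hasDerivAt_xa (ha : a ∈ Ioo (-1) 0 ∪ Ioi 0) (t : ℝ) :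
    HasDerivAt (xa a) (deriv (xa a) t) t :=
  ((isProfile ha).differentiable_x t).hasDerivAt

theorem continuous_xa (ha : a ∈ Ioo (-1) 0 ∪ Ioi 0) : Continuous (xa a) :=
  (isProfile ha).differentiable_x.continuous

theorem contDiff_xa (ha : a ∈ Ioo (-1) 0 ∪ Ioi 0) : ContDiff ℝ 1 (xa a) :=
  contDiff_one_iff_deriv.2 ⟨(isProfile ha).differentiable_x,
    continuous_iff_continuousAt.2 fun t => ((isProfile ha).hasDerivAt_deriv_x t).continuousAt⟩

theorem one_add_two_gam_pos (a : ℝ) : 0 < 1 + 2 * gam a := by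
  have : 1 + 2 * gam a = (1 + a) ^ 2 + a ^ 2 := by rw [gam]; ring
  rw [this]
  nlinarith [sq_nonneg (1 + 2 * a)]

/-- The conservation law in terms of the potential. -/
theorem pa_eq (ha : a ∈ Ioo (-1) 0 ∪ Ioi 0) (t : ℝ) :
    pa a t = 1 + 2 * gam a - (deriv (xa a) t / xa a t) ^ 2 := by
  have h := (isProfile ha).conservation t
  have := (xa_pos ha t).ne'
  rw [div_pow, h, pa]
  field_simp
  ring

theorem pa_nonneg (a t : ℝ) : 0 ≤ pa a t := by rw [pa]; positivity

theorem pa_le (ha : a ∈ Ioo (-1) 0 ∪ Ioi 0) (t : ℝ) : pa a t ≤ 1 + 2 * gam a := by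
  rw [pa_eq ha]; linarith [sq_nonneg (deriv (xa a) t / xa a t)]

theorem xa_sq_le (ha : a ∈ Ioo (-1) 0 ∪ Ioi 0) (t : ℝ) : xa a t ^ 2 ≤ 1 + 2 * gam a := by
  have h1 := pa_le ha t
  have h2 : 0 ≤ gam a ^ 2 / xa a t ^ 2 := by positivity
  rw [pa] at h1
  linarith

theorem abs_potential_le (ha : a ∈ Ioo (-1) 0 ∪ Ioi 0) (j : ℕ) (t : ℝ) :
    |(j : ℝ) ^ 2 - 2 * pa a t| ≤ (j : ℝ) ^ 2 + 2 * (1 + 2 * gam a) := by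
  have h1 := pa_nonneg a t
  have h2 := pa_le ha t
  have h3 := sq_nonneg (j : ℝ)
  rw [abs_le]
  constructor <;> linarith

/-- The profile is symmetric: `x(t) - x(-t)` solves a linear equation with zero Cauchy data. -/
theorem xa_neg (ha : a ∈ Ioo (-1) 0 ∪ Ioi 0) (t : ℝ) : xa a (-t) = xa a t := by
  have h := isProfile ha
  set x := xa a with hxdef
  have hd : ∀ t, HasDerivAt (fun t => x (-t)) (-deriv x (-t)) t := fun t => by
    convert! (hasDerivAt_xa ha (-t)).scomp t (hasDerivAt_neg t) using 1
    simp [hxdef]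
  have hd2 : ∀ t, HasDerivAt (fun t => -deriv x (-t))
      ((1 + 2 * gam a) * x (-t) - 2 * x (-t) ^ 3) t := fun t => by
    convert! ((h.hasDerivAt_deriv_x (-t)).scomp t (hasDerivAt_neg t)).neg using 1
    simp
  have hB := one_add_two_gam_pos a
  have key := linear_ode_unique (t₀ := 0) (c := -(|t| + 1)) (d := |t| + 1)
    (q := fun t => 1 + 2 * gam a - 2 * (x (-t) ^ 2 + x (-t) * x t + x t ^ 2))
    (K := 7 * (1 + 2 * gam a))
    (f := fun t => x (-t) - x t) (f' := fun t => -deriv x (-t) - deriv x t)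
    (g := fun _ => 0) (g' := fun _ => 0) ?_ ?_ (fun t _ => (hd t).sub (hasDerivAt_xa ha t))
    (fun t _ => ?_) (fun t _ => hasDerivAt_const _ _) (fun t _ => ?_) (by simp) ?_
  · have ht : t ∈ Ioo (-(|t| + 1)) (|t| + 1) := by
      constructor
      · linarith [neg_abs_le t]
      · linarith [le_abs_self t]
    have := key ht
    simp only at this
    linarith
  · intro t
    have h1 := xa_sq_le ha t
    have h2 := xa_sq_le ha (-t)
    simp only [← hxdef] at h1 h2
    rw [abs_le]
    constructor <;> nlinarith [sq_nonneg (x t - x (-t)), sq_nonneg (x t + x (-t))]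
  · constructor <;> linarith [abs_nonneg t]
  · convert! (hd2 t).sub (h.hasDerivAt_deriv_x t) using 1
    ring
  · simpa using hasDerivAt_const t (0 : ℝ)
  · simp [h.deriv_x_zero]

theorem pa_neg (ha : a ∈ Ioo (-1) 0 ∪ Ioi 0) (t : ℝ) : pa a (-t) = pa a t := by
  simp only [pa, xa_neg ha]

/-- The logarithmic derivative `x'/x` of the profile. -/
theorem hasDerivAt_deriv_xa_div (ha : a ∈ Ioo (-1) 0 ∪ Ioi 0) (t : ℝ) :
    HasDerivAt (fun t => deriv (xa a) t / xa a t)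
      (gam a ^ 2 / xa a t ^ 2 - xa a t ^ 2) t := by
  have h := isProfile ha
  have hne := (xa_pos ha t).ne'
  convert! (h.hasDerivAt_deriv_x t).div (hasDerivAt_xa ha t) hne using 1
  have hc := h.conservation t
  field_simp
  linear_combination hc

/-! ### Even solutions of the mode equations -/

theorem IsEvenSol.hasDerivAt {j : ℕ} {u : ℝ → ℝ} (h : IsEvenSol a j u) (t : ℝ) :
    HasDerivAt u (deriv u t) t := (h.differentiable t).hasDerivAt

/-- A solution of the mode equation on a symmetric open interval with zero derivative at the
origin is a multiple of the even solution. -/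
theorem IsEvenSol.eqOn_Ioo (ha : a ∈ Ioo (-1) 0 ∪ Ioi 0) {j : ℕ} {u : ℝ → ℝ}
    (h : IsEvenSol a j u) {T : ℝ} (hT : 0 < T) {f g : ℝ → ℝ}
    (hf : ∀ t ∈ Ioo (-T) T, HasDerivAt f (g t) t)
    (hg : ∀ t ∈ Ioo (-T) T, HasDerivAt g (((j : ℝ) ^ 2 - 2 * pa a t) * f t) t)
    (hg0 : g 0 = 0) : ∀ t ∈ Ioo (-T) T, f t = (-1) ^ (j + 1) * f 0 * u t := by
  refine linear_ode_unique (t₀ := 0) (abs_potential_le ha j) ⟨by linarith, hT⟩ hf hg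
    (g' := fun t => (-1) ^ (j + 1) * f 0 * deriv u t)
    (fun t _ => (h.hasDerivAt t).const_mul _) (fun t _ => ?_) ?_ ?_
  · convert! (h.hasDerivAt_deriv t).const_mul ((-1) ^ (j + 1) * f 0) using 1
    ring
  · rw [h.zero]
    have : ((-1 : ℝ) ^ (j + 1)) * (-1) ^ (j + 1) = 1 := by rw [← mul_pow]; norm_num
    linear_combination (-f 0) * this
  · rw [hg0, h.deriv_zero, mul_zero]

theorem IsEvenSol.eq_of_global (ha : a ∈ Ioo (-1) 0 ∪ Ioi 0) {j : ℕ} {u : ℝ → ℝ}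
    (h : IsEvenSol a j u) {f g : ℝ → ℝ} (hf : ∀ t, HasDerivAt f (g t) t)
    (hg : ∀ t, HasDerivAt g (((j : ℝ) ^ 2 - 2 * pa a t) * f t) t)
    (hg0 : g 0 = 0) (t : ℝ) : f t = (-1) ^ (j + 1) * f 0 * u t := by
  refine h.eqOn_Ioo ha (T := |t| + 1) (by positivity) (fun t _ => hf t) (fun t _ => hg t) hg0 t ?_
  constructor
  · linarith [neg_abs_le t]
  · linarith [le_abs_self t]

theorem IsEvenSol.even (ha : a ∈ Ioo (-1) 0 ∪ Ioi 0) {j : ℕ} {u : ℝ → ℝ}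
    (h : IsEvenSol a j u) (t : ℝ) : u (-t) = u t := by
  have := h.eq_of_global ha (f := fun t => u (-t)) (g := fun t => -deriv u (-t))
    (fun t => by
      convert! (h.hasDerivAt (-t)).scomp t (hasDerivAt_neg t) using 1
      simp)
    (fun t => by
      convert! ((h.hasDerivAt_deriv (-t)).scomp t (hasDerivAt_neg t)).neg using 1
      simp [pa_neg ha])
    (by simp [h.deriv_zero]) t
  simp only [neg_zero, h.zero, ← mul_pow] at this
  simpa using this

theorem contDiff_pa (ha : a ∈ Ioo (-1) 0 ∪ Ioi 0) : ContDiff ℝ 1 (pa a) :=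
  ((contDiff_xa ha).pow 2).add (contDiff_const.div ((contDiff_xa ha).pow 2)
    fun t => (pow_pos (xa_pos ha t) 2).ne')

theorem IsEvenSol.contDiff (ha : a ∈ Ioo (-1) 0 ∪ Ioi 0) {j : ℕ} {u : ℝ → ℝ}
    (h : IsEvenSol a j u) : ContDiff ℝ 3 u := by
  have hd2 : deriv (deriv u) = fun t => ((j : ℝ) ^ 2 - 2 * pa a t) * u t :=
    funext fun t => (h.hasDerivAt_deriv t).deriv
  have hd : Differentiable ℝ (deriv u) := fun t => (h.hasDerivAt_deriv t).differentiableAt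
  have h1 : ContDiff ℝ 1 u := contDiff_one_iff_deriv.2 ⟨h.differentiable, hd.continuous⟩
  have h2 : ContDiff ℝ 1 (deriv (deriv u)) := by
    rw [hd2]
    exact (contDiff_const.sub (contDiff_const.mul (contDiff_pa ha))).mul h1
  have h3 : ContDiff ℝ (1 + 1) (deriv u) :=
    contDiff_succ_iff_deriv.2 ⟨hd, by simp, h2⟩
  have h4 : ContDiff ℝ (1 + 1 + 1) u :=
    contDiff_succ_iff_deriv.2 ⟨h.differentiable, by simp, h3⟩
  convert h4 using 1
  norm_num

/-- The even solution of the first mode: `w_{a,1} = x - γ / x`. -/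
theorem wa_one_eq (ha : a ∈ Ioo (-1) 0 ∪ Ioi 0) (t : ℝ) :
    wa a 1 t = xa a t - gam a / xa a t := by
  have h := isProfile ha
  have hne := fun t => (xa_pos ha t).ne'
  have key := (isEvenSol_wa_one ha).eq_of_global ha (f := fun t => xa a t - gam a / xa a t)
    (g := fun t => deriv (xa a) t * (1 + gam a / xa a t ^ 2)) (fun t => ?_) (fun t => ?_) ?_ t
  · rw [key]
    simp only [h.x_zero, gam]
    have := (one_add_pos ha).ne'
    field_simp
    ring
  · convert! (hasDerivAt_xa ha t).sub ((hasDerivAt_const t (gam a)).div (hasDerivAt_xa ha t)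
      (hne t)) using 1
    have := hne t
    field_simp
    ring
  · have e1 := (hasDerivAt_const t (gam a)).div ((hasDerivAt_xa ha t).pow 2)
      (pow_ne_zero 2 (hne t))
    convert! (h.hasDerivAt_deriv_x t).mul (e1.const_add 1) using 1
    have hc := h.conservation t
    have := hne t
    simp only [pa]
    norm_num
    field_simp
    linear_combination (2 * gam a) * hc
  · simp [h.deriv_x_zero]

/-- The even solution of the zeroth mode, up to normalization: it comes from varying the
parameter `a`. -/
theorem wa_zero_eq (ha : a ∈ Ioo (-1) 0 ∪ Ioi 0) (t : ℝ) :
    (1 + 2 * a) * wa a 0 t = 1 + 2 * gam a - 2 * xa a t ^ 2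
      + deriv (xa a) t / xa a t * (2 * za a t - t) := by
  have h := isProfile ha
  have hne := fun t => (xa_pos ha t).ne'
  have hz : ∀ t, HasDerivAt (fun t => 2 * za a t - t) (2 * (xa a t ^ 2 - gam a) - 1) t :=
    fun t => ((h.hasDerivAt_z t).const_mul 2).sub (hasDerivAt_id t)
  have hr := hasDerivAt_deriv_xa_div ha
  have key := (isEvenSol_wa_zero ha).eq_of_global ha
    (f := fun t => 1 + 2 * gam a - 2 * xa a t ^ 2 + deriv (xa a) t / xa a t * (2 * za a t - t))
    (g := fun t => (gam a ^ 2 / xa a t ^ 2 - xa a t ^ 2) * (2 * za a t - t)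
          - (1 + 2 * gam a + 2 * xa a t ^ 2) * (deriv (xa a) t / xa a t))
    (fun t => ?_) (fun t => ?_) ?_ t
  · rw [key]
    simp only [h.x_zero, h.deriv_x_zero, gam]
    ring
  · have e1 := (((hasDerivAt_xa ha t).pow 2).const_mul 2).const_sub (1 + 2 * gam a)
    convert! e1.add ((hr t).mul (hz t)) using 1
    have := hne t
    norm_num
    field_simp
    ring
  · have e1 := ((hasDerivAt_const t (gam a ^ 2)).div ((hasDerivAt_xa ha t).pow 2)
      (pow_ne_zero 2 (hne t))).sub ((hasDerivAt_xa ha t).pow 2)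
    have e3 := ((((hasDerivAt_xa ha t).pow 2).const_mul 2).const_add (1 + 2 * gam a)).mul (hr t)
    convert! (e1.mul (hz t)).sub e3 using 1
    have hc := h.conservation t
    have := hne t
    simp only [pa]
    norm_num
    field_simp
    linear_combination (4 * xa a t ^ 3) * hc
  · simp [h.deriv_x_zero, h.z_zero]

/-- For nodoids the functions `w_{a,0}` and `w_{a,1}` have no common zero on `(0, ∞)`. With
`r = x'/x` and `y = 2z - t` one has `(y + r)' = -r²`. At a zero of `w_{a,1}` one has `r = ±1`, and
if `w_{a,0}` vanishes there as well, then `y + r` vanishes there, as it does at `0`. So `r = 0` in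
between, which is impossible as `x(0) = 1 + a` and `x² = γ` at a zero of `w_{a,1}`. -/
theorem wa_one_ne_zero (ha : 0 < a) {T : ℝ} (hT : 0 < T) (h0 : wa a 0 T = 0) :
    wa a 1 T ≠ 0 := by
  have ha' : a ∈ Ioo (-1) 0 ∪ Ioi 0 := Or.inr ha
  have h := isProfile ha'
  have hpos := xa_pos ha'
  intro h1
  rw [wa_one_eq ha'] at h1
  have hxT : xa a T ^ 2 = gam a := by
    have := (hpos T).ne'
    field_simp at h1
    linarith
  set r : ℝ → ℝ := fun t => deriv (xa a) t / xa a t with hr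
  have hrT : r T ^ 2 = 1 := by
    have e := pa_eq ha' T
    have hg : gam a ≠ 0 := hxT ▸ (pow_pos (hpos T) 2).ne'
    rw [pa, hxT] at e
    have e2 : gam a ^ 2 / gam a = gam a := by field_simp
    simp only [hr]
    linarith
  have hwT := wa_zero_eq ha' T
  rw [h0, mul_zero, hxT] at hwT
  have hy : 2 * za a T - T + r T = 0 := by
    have e : 1 + r T * (2 * za a T - T) = 0 := by simp only [hr]; linarith
    linear_combination r T * e - (2 * za a T - T) * hrT
  have hd : ∀ t, HasDerivAt (fun t => 2 * za a t - t + r t) (-(r t) ^ 2) t := fun t => by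
    convert! (((h.hasDerivAt_z t).const_mul 2).sub (hasDerivAt_id t)).add
      (hasDerivAt_deriv_xa_div ha' t) using 1
    have e := pa_eq ha' t
    rw [pa] at e
    simp only [hr]
    linarith
  have hanti : Antitone fun t => 2 * za a t - t + r t :=
    antitone_of_deriv_nonpos (fun t => (hd t).differentiableAt) fun t => by
      rw [(hd t).deriv]; linarith [sq_nonneg (r t)]
  have hzero : ∀ t ∈ Icc 0 T, 2 * za a t - t + r t = 0 := fun t ht => by
    have e1 := hanti ht.1
    have e2 := hanti ht.2
    have e0 : 2 * za a 0 - 0 + r 0 = 0 := by simp [hr, h.z_zero, h.deriv_x_zero]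
    exact le_antisymm (e1.trans e0.le) (hy.ge.trans e2)
  have hx' : ∀ t ∈ Ioo 0 T, deriv (xa a) t = 0 := fun t ht => by
    have e1 : HasDerivAt (fun t => 2 * za a t - t + r t) 0 t :=
      (hasDerivAt_const t (0 : ℝ)).congr_of_eventuallyEq (by
        filter_upwards [Ioo_mem_nhds ht.1 ht.2] with s hs
        exact hzero s (Ioo_subset_Icc_self hs))
    have e2 := (hd t).unique e1
    have e3 : r t = 0 := by
      have : r t ^ 2 = 0 := by linarith
      exact pow_eq_zero_iff two_ne_zero |>.1 this
    rcases div_eq_zero_iff.1 e3 with h | h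
    · exact h
    · exact absurd h (hpos t).ne'
  obtain ⟨c, hc, hce⟩ := exists_hasDerivAt_eq_slope (xa a) (deriv (xa a)) hT
    (continuous_xa ha').continuousOn fun t _ => hasDerivAt_xa ha' t
  rw [hx' c hc] at hce
  have hx0 : xa a T = xa a 0 := by
    have hT' : T - 0 ≠ 0 := by simpa using hT.ne'
    field_simp at hce
    linarith
  rw [hx0, h.x_zero, gam] at hxT
  nlinarith

end Profile

/-! ### First variation of the mean curvature: the algebra -/

/-- The mean curvature of `(A cos θ, A sin θ, B)`, where `A` and `B` are functions of `(t, θ)`,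
in terms of the partial derivatives of `A` and `B` at a point. -/
noncomputable def polarMeanCurv (A At Ah Att Ath Ahh Bt Bh Btt Bth Bhh : ℝ) : ℝ :=
  ((At ^ 2 + Bt ^ 2) * (-((Ahh - A) * (Bt * A)) + 2 * Ah * (Bt * Ah - At * Bh) + Bhh * (At * A))
    - 2 * (At * Ah + Bt * Bh) * (-(Ath * (Bt * A)) + At * (Bt * Ah - At * Bh) + Bth * (At * A))
    + (Ah ^ 2 + A ^ 2 + Bh ^ 2) * (-(Att * (Bt * A)) + Btt * (At * A)))
  * (Real.sqrt ((Bt * A) ^ 2 + (Bt * Ah - At * Bh) ^ 2 + (At * A) ^ 2))⁻¹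
  / (2 * ((At ^ 2 + Bt ^ 2) * (Ah ^ 2 + A ^ 2 + Bh ^ 2) - (At * Ah + Bt * Bh) ^ 2))

/-- The derivative at `s = 0` of `P (√D)⁻¹ / (2 D)` when `D` is a fourth power there; `W` is a
second expression for `D`. -/
theorem hasDerivAt_mul_inv_sqrt_div {P D W : ℝ → ℝ} {P' D' x : ℝ} (hx : 0 < x)
    (hP : HasDerivAt P P' 0) (hD : HasDerivAt D D' 0) (hW : HasDerivAt W D' 0)
    (hP0 : P 0 = 2 * x ^ 6) (hD0 : D 0 = x ^ 4) (hW0 : W 0 = x ^ 4) :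
    HasDerivAt (fun s => P s * (Real.sqrt (D s))⁻¹ / (2 * W s))
      (P' / (2 * x ^ 6) - 3 * D' / (2 * x ^ 4)) 0 := by
  have hs : Real.sqrt (D 0) = x ^ 2 := by
    rw [hD0, show x ^ 4 = (x ^ 2) ^ 2 by ring, Real.sqrt_sq (by positivity)]
  have hne : x ≠ 0 := hx.ne'
  have h1 : HasDerivAt (fun s => Real.sqrt (D s)) (D' / (2 * x ^ 2)) 0 := by
    have := hD.sqrt (by rw [hD0]; positivity)
    rwa [hs] at this
  have h2 := (hP.mul (h1.inv (by rw [hs]; positivity))).div (hW.const_mul 2)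
    (by rw [hW0]; positivity)
  convert! h2 using 1
  simp only [hP0, hW0, hs, Pi.mul_apply, Pi.inv_apply]
  field_simp
  ring

/-- The first variation of the mean curvature in normal direction. At the base point the profile
`x` has derivative `x p`, the height has derivative `x q`, with `p² + q² = 1`, and
`x'' = x - 2 x² q`; the normal is `(-q, p)` in the meridian plane, and the meridian has curvature
`2 - q / x`. -/
theorem hasDerivAt_polarMeanCurv {x p q : ℝ} (hx : 0 < x) (hpq : p ^ 2 + q ^ 2 = 1)
    (f ft fh ftt fth fhh : ℝ) :
    HasDerivAt (fun s : ℝ => polarMeanCurv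
      (x + s * (-(f * q)))
      (x * p + s * (-(ft * q) - f * ((2 * x - q) * p)))
      (s * (-(fh * q)))
      (x - 2 * x ^ 2 * q + s * (-(ftt * q) - 2 * ft * ((2 * x - q) * p)
        + f * (2 * (x - q) * p ^ 2 - (2 * x - q) * (1 - 2 * x * q))))
      (s * (-(fth * q) - fh * ((2 * x - q) * p)))
      (s * (-(fhh * q)))
      (x * q + s * (ft * p - f * ((2 * x - q) * q)))
      (s * (fh * p))
      (2 * x ^ 2 * p + s * (ftt * p - 2 * ft * ((2 * x - q) * q)
        + f * (2 * (x - q) * p * q - (2 * x - q) * (2 * x * p))))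
      (s * (fth * p - fh * ((2 * x - q) * q)))
      (s * (fhh * p)))
      ((ftt + fhh + 2 * (x ^ 2 + (x - q) ^ 2) * f) / (2 * x ^ 2)) 0 := by
  have lin : ∀ c d : ℝ, HasDerivAt (fun s : ℝ => c + s * d) d 0 := fun c d => by
    simpa using ((hasDerivAt_id (0 : ℝ)).mul_const d).const_add c
  have lin0 : ∀ d : ℝ, HasDerivAt (fun s : ℝ => s * d) d 0 := fun d => by
    simpa using (hasDerivAt_id (0 : ℝ)).mul_const d
  have hp2 : p ^ 2 = 1 - q ^ 2 := by linarith
  have hp3 : p ^ 3 = p * (1 - q ^ 2) := by rw [← hp2]; ring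
  have hp4 : p ^ 4 = (1 - q ^ 2) ^ 2 := by rw [← hp2]; ring
  unfold polarMeanCurv
  generalize eA : -(f * q) = A1
  generalize eAt : -(ft * q) - f * ((2 * x - q) * p) = At1
  generalize eAh : -(fh * q) = Ah1
  generalize eAtt : -(ftt * q) - 2 * ft * ((2 * x - q) * p)
        + f * (2 * (x - q) * p ^ 2 - (2 * x - q) * (1 - 2 * x * q)) = Att1
  generalize eAth : -(fth * q) - fh * ((2 * x - q) * p) = Ath1
  generalize eAhh : -(fhh * q) = Ahh1
  generalize eBt : ft * p - f * ((2 * x - q) * q) = Bt1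
  generalize eBh : fh * p = Bh1
  generalize eBtt : ftt * p - 2 * ft * ((2 * x - q) * q)
        + f * (2 * (x - q) * p * q - (2 * x - q) * (2 * x * p)) = Btt1
  generalize eBth : fth * p - fh * ((2 * x - q) * q) = Bth1
  generalize eBhh : fhh * p = Bhh1
  have hA := lin x A1
  have hAt := lin (x * p) At1
  have hAh := lin0 Ah1
  have hAtt := lin (x - 2 * x ^ 2 * q) Att1
  have hAth := lin0 Ath1
  have hAhh := lin0 Ahh1
  have hBt := lin (x * q) Bt1
  have hBh := lin0 Bh1
  have hBtt := lin (2 * x ^ 2 * p) Btt1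
  have hBth := lin0 Bth1
  have hBhh := lin0 Bhh1
  have hE := (hAt.pow 2).add (hBt.pow 2)
  have hF := (hAt.mul hAh).add (hBt.mul hBh)
  have hG := ((hAh.pow 2).add (hA.pow 2)).add (hBh.pow 2)
  have hBA := hBt.mul hA
  have hAA := hAt.mul hA
  have hC := (hBt.mul hAh).sub (hAt.mul hBh)
  have hl := ((hAtt.mul hBA).neg).add (hBtt.mul hAA)
  have hm := (((hAth.mul hBA).neg).add (hAt.mul hC)).add (hBth.mul hAA)
  have hn := ((((hAhh.sub hA).mul hBA).neg).add ((hAh.const_mul 2).mul hC)).add (hBhh.mul hAA)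
  have hP := ((hE.mul hn).sub ((hF.const_mul 2).mul hm)).add (hG.mul hl)
  have hD := ((hBA.pow 2).add (hC.pow 2)).add (hAA.pow 2)
  have hW := (hE.mul hG).sub (hF.pow 2)
  have key := hasDerivAt_mul_inv_sqrt_div (D' := -4 * x ^ 4 * f)
    (P' := 2 * x ^ 6 * ((ftt + fhh + 2 * (x ^ 2 + (x - q) ^ 2) * f) / (2 * x ^ 2) - 6 * f))
    hx (hP.congr_deriv ?_) (hD.congr_deriv ?_) (hW.congr_deriv ?_) ?_ ?_ ?_
  · convert! key using 1
    field_simp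
    ring
  · simp
    subst eA eAt eAh eAtt eAth eAhh eBt eBh eBtt eBth eBhh
    field_simp
    ring_nf
    simp only [hp2, hp3, hp4]
    ring
  · simp
    subst eA eAt eAh eAtt eAth eAhh eBt eBh eBtt eBth eBhh
    ring_nf
    simp only [hp2]
    ring
  · simp
    subst eA eAt eAh eAtt eAth eAhh eBt eBh eBtt eBth eBhh
    ring_nf
    simp only [hp2]
    ring
  · simp
    ring_nf
    simp only [hp2]
    ring
  · simp
    ring_nf
    simp only [hp2]
    ring
  · simp
    ring_nf
    simp only [hp2]
    ring

/-! ### Partial derivatives on a strip -/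

section Partials

variable {E : Type*} [NormedAddCommGroup E] [NormedSpace ℝ E]

/-- `X` has on `I × ℝ` the partial derivatives `Xt`, `Xh` (in `θ`), `Xtt`, `Xth`, `Xhh`, those in
the first variable being taken within `I`. -/
structure HasPartials (I : Set ℝ) (X Xt Xh Xtt Xth Xhh : ℝ → ℝ → E) : Prop where
  t : ∀ t ∈ I, ∀ θ, HasDerivWithinAt (fun s => X s θ) (Xt t θ) I t
  h : ∀ t ∈ I, ∀ θ, HasDerivAt (fun η => X t η) (Xh t θ) θ
  tt : ∀ t ∈ I, ∀ θ, HasDerivWithinAt (fun s => Xt s θ) (Xtt t θ) I t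
  th : ∀ t ∈ I, ∀ θ, HasDerivAt (fun η => Xt t η) (Xth t θ) θ
  hh : ∀ t ∈ I, ∀ θ, HasDerivAt (fun η => Xh t η) (Xhh t θ) θ

namespace HasPartials

variable {I : Set ℝ} {X Xt Xh Xtt Xth Xhh Y Yt Yh Ytt Yth Yhh : ℝ → ℝ → E}

theorem congr (hX : HasPartials I X Xt Xh Xtt Xth Xhh) (h : ∀ t ∈ I, ∀ θ, Y t θ = X t θ) :
    HasPartials I Y Xt Xh Xtt Xth Xhh where
  t t ht θ := (hX.t t ht θ).congr (fun s hs => h s hs θ) (h t ht θ)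
  h t ht θ := by
    have : (fun η => Y t η) = fun η => X t η := funext fun η => h t ht η
    rw [this]
    exact hX.h t ht θ
  tt := hX.tt
  th := hX.th
  hh := hX.hh

theorem add (hX : HasPartials I X Xt Xh Xtt Xth Xhh) (hY : HasPartials I Y Yt Yh Ytt Yth Yhh) :
    HasPartials I (X + Y) (Xt + Yt) (Xh + Yh) (Xtt + Ytt) (Xth + Yth) (Xhh + Yhh) where
  t t ht θ := (hX.t t ht θ).add (hY.t t ht θ)
  h t ht θ := (hX.h t ht θ).add (hY.h t ht θ)
  tt t ht θ := (hX.tt t ht θ).add (hY.tt t ht θ)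
  th t ht θ := (hX.th t ht θ).add (hY.th t ht θ)
  hh t ht θ := (hX.hh t ht θ).add (hY.hh t ht θ)

theorem const_smul (c : ℝ) (hX : HasPartials I X Xt Xh Xtt Xth Xhh) :
    HasPartials I (c • X) (c • Xt) (c • Xh) (c • Xtt) (c • Xth) (c • Xhh) where
  t t ht θ := (hX.t t ht θ).const_smul c
  h t ht θ := (hX.h t ht θ).const_smul c
  tt t ht θ := (hX.tt t ht θ).const_smul c
  th t ht θ := (hX.th t ht θ).const_smul c
  hh t ht θ := (hX.hh t ht θ).const_smul c

variable (hI : UniqueDiffOn ℝ I) (hX : HasPartials I X Xt Xh Xtt Xth Xhh) {t : ℝ} (ht : t ∈ I)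
  (θ : ℝ)

include hX ht in
theorem dth_eq : dth X t θ = Xh t θ := (hX.h t ht θ).deriv

include hX ht in
theorem dth_dth_eq : dth (dth X) t θ = Xhh t θ := by
  have : (fun η => dth X t η) = fun η => Xh t η := funext fun η => hX.dth_eq ht η
  rw [dth, this]
  exact (hX.hh t ht θ).deriv

include hI hX ht

theorem dt_eq : dt I X t θ = Xt t θ := (hX.t t ht θ).derivWithin (hI t ht)

theorem dth_dt_eq : dth (dt I X) t θ = Xth t θ := by
  have : (fun η => dt I X t η) = fun η => Xt t η := funext fun η => hX.dt_eq hI ht η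
  rw [dth, this]
  exact (hX.th t ht θ).deriv

theorem dt_dt_eq : dt I (dt I X) t θ = Xtt t θ := by
  rw [dt, derivWithin_congr (fun s hs => hX.dt_eq hI hs θ) (hX.dt_eq hI ht θ)]
  exact (hX.tt t ht θ).derivWithin (hI t ht)

end HasPartials

/-- A function of class `C^{n+1}` on a strip has first partial derivatives of class `C^n`. -/
theorem exists_first_partials {I : Set ℝ} (hI : UniqueDiffOn ℝ I) {n : ℕ} {X : ℝ → ℝ → E}
    (h : ContDiffOn ℝ (n + 1) (fun p : ℝ × ℝ => X p.1 p.2) (I ×ˢ univ)) :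
    ∃ Xt Xh : ℝ → ℝ → E,
      ContDiffOn ℝ n (fun p : ℝ × ℝ => Xt p.1 p.2) (I ×ˢ univ) ∧
      ContDiffOn ℝ n (fun p : ℝ × ℝ => Xh p.1 p.2) (I ×ˢ univ) ∧
      (∀ t ∈ I, ∀ θ, HasDerivWithinAt (fun s => X s θ) (Xt t θ) I t) ∧
      ∀ t ∈ I, ∀ θ, HasDerivAt (fun η => X t η) (Xh t θ) θ := by
  have hS : UniqueDiffOn ℝ (I ×ˢ (univ : Set ℝ)) := hI.prod uniqueDiffOn_univ
  have hD := h.fderivWithin hS (m := n) le_rfl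
  have hdiff := h.differentiableOn (by simp)
  set D := fderivWithin ℝ (fun p : ℝ × ℝ => X p.1 p.2) (I ×ˢ univ) with hDdef
  refine ⟨fun t θ => D (t, θ) (1, 0), fun t θ => D (t, θ) (0, 1), hD.clm_apply contDiffOn_const,
    hD.clm_apply contDiffOn_const, fun t ht θ => ?_, fun t ht θ => ?_⟩
  · have h1 := (hdiff (t, θ) ⟨ht, mem_univ _⟩).hasFDerivWithinAt
    have h2 : HasDerivWithinAt (fun s : ℝ => (s, θ)) (1, 0) I t :=
      (hasDerivWithinAt_id t I).prodMk (hasDerivWithinAt_const t I θ)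
    have h3 : MapsTo (fun s : ℝ => (s, θ)) I (I ×ˢ univ) := fun s hs => ⟨hs, mem_univ _⟩
    exact h1.comp_hasDerivWithinAt t h2 h3
  · have h1 := (hdiff (t, θ) ⟨ht, mem_univ _⟩).hasFDerivWithinAt
    have h2 : HasDerivWithinAt (fun η : ℝ => (t, η)) (0, 1) univ θ :=
      (hasDerivWithinAt_const θ univ t).prodMk (hasDerivWithinAt_id θ univ)
    have h3 : MapsTo (fun η : ℝ => (t, η)) univ (I ×ˢ univ) := fun η _ => ⟨ht, mem_univ _⟩
    exact (h1.comp_hasDerivWithinAt θ h2 h3).hasDerivAt Filter.univ_mem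

/-- A function of class `C²` on a strip has partial derivatives up to the second order; `Xt`,
`Xtt` and `Xhh` are continuous up to the boundary. -/
theorem exists_hasPartials {I : Set ℝ} (hI : UniqueDiffOn ℝ I) {X : ℝ → ℝ → E}
    (h : ContDiffOn ℝ 2 (fun p : ℝ × ℝ => X p.1 p.2) (I ×ˢ univ)) :
    ∃ Xt Xh Xtt Xth Xhh : ℝ → ℝ → E, HasPartials I X Xt Xh Xtt Xth Xhh ∧
      ContinuousOn (fun p : ℝ × ℝ => Xt p.1 p.2) (I ×ˢ univ) ∧
      ContinuousOn (fun p : ℝ × ℝ => Xtt p.1 p.2) (I ×ˢ univ) ∧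
      ContinuousOn (fun p : ℝ × ℝ => Xhh p.1 p.2) (I ×ˢ univ) := by
  obtain ⟨Xt, Xh, ht, hh, h1, h2⟩ := exists_first_partials hI (n := 1) (by exact_mod_cast h)
  obtain ⟨Xtt, Xth, htt, _, h3, h4⟩ := exists_first_partials hI (n := 0)
    (by simpa using ht)
  obtain ⟨_, Xhh, _, hhh, _, h5⟩ := exists_first_partials hI (n := 0)
    (by simpa using hh)
  exact ⟨Xt, Xh, Xtt, Xth, Xhh, ⟨h1, h2, h3, h4, h5⟩, ht.continuousOn,
    htt.continuousOn, hhh.continuousOn⟩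

end Partials

/-! ### Mean curvature in polar coordinates -/

/-- The vector with components `p, b, q` in the frame of cylindrical coordinates at angle `θ`. -/
noncomputable def polarVec (θ p b q : ℝ) : Fin 3 → ℝ :=
  ![p * Real.cos θ - b * Real.sin θ, p * Real.sin θ + b * Real.cos θ, q]

theorem polarVec_dot (θ p b q p' b' q' : ℝ) :
    polarVec θ p b q ⬝ᵥ polarVec θ p' b' q' = p * p' + b * b' + q * q' := by
  simp only [polarVec, dotProduct, Fin.sum_univ_three, Matrix.cons_val]
  linear_combination (p * p' + b * b') * Real.sin_sq_add_cos_sq θ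

theorem polarVec_cross (θ p b q p' b' q' : ℝ) :
    crossProduct (polarVec θ p b q) (polarVec θ p' b' q') =
      polarVec θ (b * q' - q * b') (q * p' - p * q') (p * b' - b * p') := by
  rw [cross_apply]
  simp only [polarVec, Matrix.cons_val]
  ext i
  fin_cases i
  · simp; ring
  · simp; ring
  · simp; linear_combination (p * b' - b * p') * Real.sin_sq_add_cos_sq θ

theorem hasDerivAt_polarVec {θ p' b' q' : ℝ} {p b q : ℝ → ℝ} (hp : HasDerivAt p p' θ)
    (hb : HasDerivAt b b' θ) (hq : HasDerivAt q q' θ) :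
    HasDerivAt (fun η => polarVec η (p η) (b η) (q η))
      (polarVec θ (p' - b θ) (p θ + b') q') θ := by
  rw [hasDerivAt_pi]
  have hc := Real.hasDerivAt_cos θ
  have hs := Real.hasDerivAt_sin θ
  intro i
  fin_cases i
  · simp only [polarVec]
    convert! (hp.mul hc).sub (hb.mul hs) using 1
    simp; ring
  · simp only [polarVec]
    convert! (hp.mul hs).add (hb.mul hc) using 1
    simp; ring
  · simpa [polarVec] using hq

theorem hasDerivWithinAt_polarVec {I : Set ℝ} {t p' b' q' : ℝ} (θ : ℝ) {p b q : ℝ → ℝ}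
    (hp : HasDerivWithinAt p p' I t) (hb : HasDerivWithinAt b b' I t)
    (hq : HasDerivWithinAt q q' I t) :
    HasDerivWithinAt (fun s => polarVec θ (p s) (b s) (q s)) (polarVec θ p' b' q') I t := by
  rw [hasDerivWithinAt_pi]
  intro i
  fin_cases i
  · simpa [polarVec, Pi.sub_def] using (hp.mul_const (Real.cos θ)).sub (hb.mul_const (Real.sin θ))
  · simpa [polarVec, Pi.add_def] using (hp.mul_const (Real.sin θ)).add (hb.mul_const (Real.cos θ))
  · simpa [polarVec] using hq

section Polar

variable {I : Set ℝ} {A At Ah Att Ath Ahh B Bt Bh Btt Bth Bhh : ℝ → ℝ → ℝ}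

theorem HasPartials.polarVec (hA : HasPartials I A At Ah Att Ath Ahh)
    (hB : HasPartials I B Bt Bh Btt Bth Bhh) :
    HasPartials I (fun t θ => polarVec θ (A t θ) 0 (B t θ))
      (fun t θ => Delaunay.polarVec θ (At t θ) 0 (Bt t θ))
      (fun t θ => Delaunay.polarVec θ (Ah t θ) (A t θ) (Bh t θ))
      (fun t θ => Delaunay.polarVec θ (Att t θ) 0 (Btt t θ))
      (fun t θ => Delaunay.polarVec θ (Ath t θ) (At t θ) (Bth t θ))
      (fun t θ => Delaunay.polarVec θ (Ahh t θ - A t θ) (2 * Ah t θ) (Bhh t θ)) where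
  t t ht θ := hasDerivWithinAt_polarVec θ (hA.t t ht θ) (hasDerivWithinAt_const _ _ _)
    (hB.t t ht θ)
  tt t ht θ := hasDerivWithinAt_polarVec θ (hA.tt t ht θ) (hasDerivWithinAt_const _ _ _)
    (hB.tt t ht θ)
  h t ht θ := by
    simpa using hasDerivAt_polarVec (hA.h t ht θ) (hasDerivAt_const θ (0 : ℝ)) (hB.h t ht θ)
  th t ht θ := by
    simpa using hasDerivAt_polarVec (hA.th t ht θ) (hasDerivAt_const θ (0 : ℝ)) (hB.th t ht θ)
  hh t ht θ := by
    simpa [two_mul] using hasDerivAt_polarVec (hA.hh t ht θ) (hA.h t ht θ) (hB.hh t ht θ)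

theorem normal_eq (hI : UniqueDiffOn ℝ I) {X : ℝ → ℝ → Fin 3 → ℝ}
    (hA : HasPartials I A At Ah Att Ath Ahh) (hB : HasPartials I B Bt Bh Btt Bth Bhh)
    (hX : ∀ t ∈ I, ∀ θ, X t θ = polarVec θ (A t θ) 0 (B t θ)) {t : ℝ} (ht : t ∈ I) (θ : ℝ) :
    normal I X t θ =
      (Real.sqrt ((Bt t θ * A t θ) ^ 2 + (Bt t θ * Ah t θ - At t θ * Bh t θ) ^ 2
        + (At t θ * A t θ) ^ 2))⁻¹ •
      polarVec θ (-(Bt t θ * A t θ)) (Bt t θ * Ah t θ - At t θ * Bh t θ) (At t θ * A t θ) := by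
  have hP := (hA.polarVec hB).congr hX
  simp only [normal]
  rw [hP.dt_eq hI ht, hP.dth_eq ht, polarVec_cross, polarVec_dot]
  congr 3
  · ring
  · ring
  · ring

theorem meanCurv_eq (hI : UniqueDiffOn ℝ I) {X : ℝ → ℝ → Fin 3 → ℝ}
    (hA : HasPartials I A At Ah Att Ath Ahh) (hB : HasPartials I B Bt Bh Btt Bth Bhh)
    (hX : ∀ t ∈ I, ∀ θ, X t θ = polarVec θ (A t θ) 0 (B t θ)) {t : ℝ} (ht : t ∈ I) (θ : ℝ) :
    meanCurv I X t θ = polarMeanCurv (A t θ) (At t θ) (Ah t θ) (Att t θ) (Ath t θ) (Ahh t θ)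
      (Bt t θ) (Bh t θ) (Btt t θ) (Bth t θ) (Bhh t θ) := by
  have hP := (hA.polarVec hB).congr hX
  simp only [meanCurv]
  rw [normal_eq hI hA hB hX ht, hP.dt_eq hI ht, hP.dth_eq ht, hP.dt_dt_eq hI ht,
    hP.dth_dt_eq hI ht, hP.dth_dth_eq ht]
  simp only [dotProduct_smul, polarVec_dot, smul_eq_mul, polarMeanCurv]
  congr 1 <;> ring

end Polar

/-! ### The Jacobi operator -/

section Jacobi

variable {a : ℝ}

theorem surf_eq (a t θ : ℝ) : surf a t θ = polarVec θ (xa a t) 0 (za a t) := by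
  simp [surf, polarVec]

/-- Functions of `t` alone, as functions on a strip. -/
theorem hasPartials_of_left {I : Set ℝ} {f f' f'' : ℝ → ℝ} (hf : ∀ t, HasDerivAt f (f' t) t)
    (hf' : ∀ t, HasDerivAt f' (f'' t) t) :
    HasPartials I (fun t _ => f t) (fun t _ => f' t) 0 (fun t _ => f'' t) 0 0 where
  t t _ _ := (hf t).hasDerivWithinAt
  h _ _ θ := hasDerivAt_const θ _
  tt t _ _ := (hf' t).hasDerivWithinAt
  th _ _ θ := hasDerivAt_const θ _
  hh _ _ θ := hasDerivAt_const θ _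

/-- The product of a function of `t` and a function on a strip. -/
theorem HasPartials.mul_left {I : Set ℝ} {φ φt φh φtt φth φhh : ℝ → ℝ → ℝ}
    (hφ : HasPartials I φ φt φh φtt φth φhh) {f f' f'' : ℝ → ℝ}
    (hf : ∀ t, HasDerivAt f (f' t) t) (hf' : ∀ t, HasDerivAt f' (f'' t) t) :
    HasPartials I (fun t θ => φ t θ * f t) (fun t θ => φt t θ * f t + φ t θ * f' t)
      (fun t θ => φh t θ * f t)
      (fun t θ => φtt t θ * f t + 2 * φt t θ * f' t + φ t θ * f'' t)
      (fun t θ => φth t θ * f t + φh t θ * f' t) (fun t θ => φhh t θ * f t) where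
  t t ht θ := (hφ.t t ht θ).mul (hf t).hasDerivWithinAt
  h t ht θ := (hφ.h t ht θ).mul_const _
  tt t ht θ := by
    convert! ((hφ.tt t ht θ).mul (hf t).hasDerivWithinAt).add
      ((hφ.t t ht θ).mul (hf' t).hasDerivWithinAt) using 1
    ring
  th t ht θ := ((hφ.th t ht θ).mul_const _).add ((hφ.h t ht θ).mul_const _)
  hh t ht θ := (hφ.hh t ht θ).mul_const _

theorem HasPartials.add_const_mul {I : Set ℝ} {x x' x'' : ℝ → ℝ}
    (hx : ∀ t, HasDerivAt x (x' t) t) (hx' : ∀ t, HasDerivAt x' (x'' t) t) (s : ℝ)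
    {φ φt φh φtt φth φhh : ℝ → ℝ → ℝ} (hφ : HasPartials I φ φt φh φtt φth φhh) :
    HasPartials I (fun t θ => x t + s * φ t θ) (fun t θ => x' t + s * φt t θ)
      (fun t θ => s * φh t θ) (fun t θ => x'' t + s * φtt t θ)
      (fun t θ => s * φth t θ) (fun t θ => s * φhh t θ) := by
  convert! (hasPartials_of_left (I := I) hx hx').add (hφ.const_smul s) using 1 <;>
  · ext t θ; simp

theorem hasDerivAt_za (ha : a ∈ Ioo (-1) 0 ∪ Ioi 0) (t : ℝ) :
    HasDerivAt (za a) (xa a t ^ 2 - gam a) t := (isProfile ha).hasDerivAt_z t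

theorem hasDerivAt_deriv_za (ha : a ∈ Ioo (-1) 0 ∪ Ioi 0) (t : ℝ) :
    HasDerivAt (fun t => xa a t ^ 2 - gam a) (2 * xa a t * deriv (xa a) t) t := by
  simpa using ((hasDerivAt_xa ha t).pow 2).sub_const (gam a)

/-- The unit normal of `X_a` is `(-z'/x, 0, x'/x)` in cylindrical coordinates. -/
theorem normal_surf (ha : a ∈ Ioo (-1) 0 ∪ Ioi 0) {I : Set ℝ} (hI : UniqueDiffOn ℝ I) {t : ℝ}
    (ht : t ∈ I) (θ : ℝ) :
    normal I (surf a) t θ =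
      polarVec θ (-((xa a t ^ 2 - gam a) / xa a t)) 0 (deriv (xa a) t / xa a t) := by
  have hpos := xa_pos ha t
  rw [normal_eq hI (hasPartials_of_left (hasDerivAt_xa ha) (isProfile ha).hasDerivAt_deriv_x)
    (hasPartials_of_left (hasDerivAt_za ha) (hasDerivAt_deriv_za ha))
    (fun t _ θ => surf_eq a t θ) ht θ]
  have hc := (isProfile ha).conservation t
  have hs : Real.sqrt (((xa a t ^ 2 - gam a) * xa a t) ^ 2 + ((xa a t ^ 2 - gam a) * 0
      - deriv (xa a) t * 0) ^ 2 + (deriv (xa a) t * xa a t) ^ 2) = xa a t ^ 2 := by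
    rw [Real.sqrt_eq_iff_mul_self_eq (by positivity) (by positivity)]
    linear_combination xa a t ^ 2 * hc
  simp only [Pi.zero_apply, hs]
  ext i
  fin_cases i
  · simp [polarVec]; field_simp
  · simp [polarVec]; field_simp
  · simp [polarVec]; field_simp

/-- The Jacobi operator of `X_a` is `(∂²/∂t² + ∂²/∂θ² + 2 p_a) / (2 x_a²)`. -/
theorem jacobi_eq (ha : a ∈ Ioo (-1) 0 ∪ Ioi 0) {I : Set ℝ} (hI : UniqueDiffOn ℝ I)
    {φ φt φh φtt φth φhh : ℝ → ℝ → ℝ} (hφ : HasPartials I φ φt φh φtt φth φhh) {t : ℝ}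
    (ht : t ∈ I) (θ : ℝ) :
    jacobi a I φ t θ =
      (φtt t θ + φhh t θ + 2 * pa a t * φ t θ) / (2 * xa a t ^ 2) := by
  have h := isProfile ha
  have hne := fun t => (xa_pos ha t).ne'
  -- the components of the normal and their first two derivatives
  have hν : ∀ t, HasDerivAt (fun t => -((xa a t ^ 2 - gam a) / xa a t))
      (-(deriv (xa a) t * (1 + gam a / xa a t ^ 2))) t := fun t => by
    convert! ((hasDerivAt_deriv_za ha t).div (hasDerivAt_xa ha t) (hne t)).neg using 1
    have := hne t
    field_simp
    ring
  have hν' : ∀ t, HasDerivAt (fun t => -(deriv (xa a) t * (1 + gam a / xa a t ^ 2)))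
      (-(((1 + 2 * gam a) * xa a t - 2 * xa a t ^ 3) * (1 + gam a / xa a t ^ 2)
        - 2 * gam a * deriv (xa a) t ^ 2 / xa a t ^ 3)) t := fun t => by
    have e1 := (hasDerivAt_const t (gam a)).div ((hasDerivAt_xa ha t).pow 2)
      (pow_ne_zero 2 (hne t))
    convert! ((h.hasDerivAt_deriv_x t).mul (e1.const_add 1)).neg using 1
    have := hne t
    norm_num
    field_simp
    ring
  have hr := hasDerivAt_deriv_xa_div ha
  have hr' : ∀ t, HasDerivAt (fun t => gam a ^ 2 / xa a t ^ 2 - xa a t ^ 2)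
      (-(2 * gam a ^ 2 * deriv (xa a) t / xa a t ^ 3) - 2 * xa a t * deriv (xa a) t) t :=
    fun t => by
      convert! ((hasDerivAt_const t (gam a ^ 2)).div ((hasDerivAt_xa ha t).pow 2)
        (pow_ne_zero 2 (hne t))).sub ((hasDerivAt_xa ha t).pow 2) using 1
      have := hne t
      norm_num
      field_simp
  -- the perturbed surface is `((x + s φ ν) cos θ, (x + s φ ν) sin θ, z + s φ r)`
  have hcurv : ∀ s : ℝ, _ := fun s =>
    meanCurv_eq (X := fun t' θ' => surf a t' θ' + (s * φ t' θ') • normal I (surf a) t' θ') hI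
    (HasPartials.add_const_mul (hasDerivAt_xa ha) h.hasDerivAt_deriv_x s (hφ.mul_left hν hν'))
    (HasPartials.add_const_mul (hasDerivAt_za ha) (hasDerivAt_deriv_za ha) s
      (hφ.mul_left hr hr')) (fun t ht θ => by
        simp only [surf_eq, normal_surf ha hI ht]
        ext i
        fin_cases i <;> simp [polarVec] <;> ring) ht θ
  rw [jacobi, funext hcurv]
  have hx := hne t
  have hc := h.conservation t
  have key := hasDerivAt_polarMeanCurv (p := deriv (xa a) t / xa a t)
    (q := (xa a t ^ 2 - gam a) / xa a t) (xa_pos ha t) (by field_simp; linear_combination hc)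
    (φ t θ) (φt t θ) (φh t θ) (φtt t θ) (φth t θ) (φhh t θ)
  -- at the point under consideration `x' = x p` and `z' = x q`
  refine Eq.trans (congrArg (fun F : ℝ → ℝ => deriv F 0) ?_) (key.deriv.trans ?_)
  · funext s
    congr 1
    · ring
    · field_simp
      ring
    · ring
    · field_simp
      ring
    · field_simp
      ring
    · ring
    · field_simp
      ring
    · field_simp
      ring
    · field_simp
      ring
  · rw [pa]
    field_simp
    ring

theorem jacobi_eq_zero_iff (ha : a ∈ Ioo (-1) 0 ∪ Ioi 0) {I : Set ℝ} (hI : UniqueDiffOn ℝ I)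
    {φ φt φh φtt φth φhh : ℝ → ℝ → ℝ} (hφ : HasPartials I φ φt φh φtt φth φhh) {t : ℝ}
    (ht : t ∈ I) (θ : ℝ) :
    jacobi a I φ t θ = 0 ↔ φtt t θ + φhh t θ + 2 * pa a t * φ t θ = 0 := by
  rw [jacobi_eq ha hI hφ ht, div_eq_zero_iff, or_iff_left]
  have := xa_pos ha t
  positivity

end Jacobi

/-! ### Even modes with Dirichlet conditions -/

section Modes

variable {a : ℝ}

theorem deriv_eq_zero_of_even {f : ℝ → ℝ} {c : ℝ} (hf : HasDerivAt f c 0)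
    (heven : ∀ᶠ t in 𝓝 0, f (-t) = f t) : c = 0 := by
  have e1 : HasDerivAt (fun t => f (-t)) (-c) 0 := by
    have e2 : HasDerivAt f c (-0) := by simpa using hf
    convert! e2.scomp (0 : ℝ) (hasDerivAt_neg (0 : ℝ)) using 1
    simp
  have := hf.unique (e1.congr_of_eventuallyEq (heven.mono fun t ht => ht.symm))
  linarith

/-- `f`, with derivative `g`, is an even solution of `f'' = (j² - 2 p_a) f` on `[-T, T]` that
vanishes at the ends. The equation is required in the interior only. -/
structure IsMode (a : ℝ) (j : ℕ) (T : ℝ) (f g : ℝ → ℝ) : Prop where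
  continuousOn : ContinuousOn f (Icc (-T) T)
  continuousOn_deriv : ContinuousOn g (Icc (-T) T)
  hasDerivAt : ∀ t ∈ Ioo (-T) T, HasDerivAt f (g t) t
  hasDerivAt_deriv : ∀ t ∈ Ioo (-T) T, HasDerivAt g (((j : ℝ) ^ 2 - 2 * pa a t) * f t) t
  even : ∀ t ∈ Icc (-T) T, f (-t) = f t
  right : f T = 0

namespace IsMode

variable {j : ℕ} {T : ℝ} {f g : ℝ → ℝ}

theorem left (h : IsMode a j T f g) (hT : 0 < T) : f (-T) = 0 := by
  rw [h.even T ⟨by linarith, le_rfl⟩, h.right]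

theorem deriv_zero (h : IsMode a j T f g) (hT : 0 < T) : g 0 = 0 := by
  have h0 : (0 : ℝ) ∈ Ioo (-T) T := ⟨by linarith, hT⟩
  refine deriv_eq_zero_of_even (h.hasDerivAt 0 h0) ?_
  filter_upwards [Ioo_mem_nhds h0.1 h0.2] with t ht
  exact h.even t (Ioo_subset_Icc_self ht)

theorem eq_even (h : IsMode a j T f g) (ha : a ∈ Ioo (-1) 0 ∪ Ioi 0) (hT : 0 < T) {u : ℝ → ℝ}
    (hu : IsEvenSol a j u) : ∀ t ∈ Icc (-T) T, f t = (-1) ^ (j + 1) * f 0 * u t := by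
  have e := hu.eqOn_Ioo ha hT h.hasDerivAt h.hasDerivAt_deriv (h.deriv_zero hT)
  have hne : -T ≠ T := by linarith
  exact Set.EqOn.of_subset_closure (s := Ioo (-T) T) e h.continuousOn
    (hu.differentiable.continuous.const_mul _).continuousOn Ioo_subset_Icc_self
    (by rw [closure_Ioo hne])

theorem apply_zero_eq_zero (h : IsMode a j T f g) (ha : a ∈ Ioo (-1) 0 ∪ Ioi 0) (hT : 0 < T)
    {u : ℝ → ℝ} (hu : IsEvenSol a j u) (huT : u T ≠ 0) : f 0 = 0 := by
  have e := h.eq_even ha hT hu T ⟨by linarith, le_rfl⟩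
  rw [h.right] at e
  have h1 : (-1 : ℝ) ^ (j + 1) ≠ 0 := pow_ne_zero _ (by norm_num)
  simpa [h1, huT] using e.symm

/-- Two modes with proportional Cauchy data at the origin, on the smaller of two intervals. -/
theorem eq_mul (h : IsMode a j T f g) (ha : a ∈ Ioo (-1) 0 ∪ Ioi 0) (hT : 0 < T)
    {T' : ℝ} {f' g' : ℝ → ℝ} (h' : IsMode a j T' f' g') (hTT' : T ≤ T') :
    ∀ t ∈ Icc (-T) T, f 0 * f' t = f' 0 * f t := by
  have hsub : Ioo (-T) T ⊆ Ioo (-T') T' := Ioo_subset_Ioo (by linarith) hTT'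
  have hsub' : Icc (-T) T ⊆ Icc (-T') T' := Icc_subset_Icc (by linarith) hTT'
  have e := linear_ode_unique (t₀ := 0) (c := -T) (d := T) (abs_potential_le ha j)
    ⟨by linarith, hT⟩
    (f := fun t => f 0 * f' t) (f' := fun t => f 0 * g' t)
    (g := fun t => f' 0 * f t) (g' := fun t => f' 0 * g t)
    (fun t ht => (h'.hasDerivAt t (hsub ht)).const_mul _)
    (fun t ht => by
      convert! (h'.hasDerivAt_deriv t (hsub ht)).const_mul (f 0) using 1
      ring)
    (fun t ht => (h.hasDerivAt t ht).const_mul _)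
    (fun t ht => by
      convert! (h.hasDerivAt_deriv t ht).const_mul (f' 0) using 1
      ring)
    (by ring) (by rw [h.deriv_zero hT, h'.deriv_zero (hT.trans_le hTT'), mul_zero, mul_zero])
  have hne : -T ≠ T := by linarith
  exact Set.EqOn.of_subset_closure (s := Ioo (-T) T) e
    (continuousOn_const.mul (h'.continuousOn.mono hsub'))
    (continuousOn_const.mul h.continuousOn) Ioo_subset_Icc_self (by rw [closure_Ioo hne])

theorem eq_zero (h : IsMode a j T f g) (ha : a ∈ Ioo (-1) 0 ∪ Ioi 0) (hT : 0 < T)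
    (h0 : f 0 = 0) : ∀ t ∈ Icc (-T) T, f t = 0 := by
  intro t ht
  have e := linear_ode_unique (t₀ := 0) (c := -T) (d := T) (abs_potential_le ha j)
    ⟨by linarith, hT⟩ h.hasDerivAt h.hasDerivAt_deriv (g := fun _ => 0) (g' := fun _ => 0)
    (fun t _ => hasDerivAt_const _ _) (fun t _ => by simpa using hasDerivAt_const t (0 : ℝ))
    h0 (h.deriv_zero hT)
  rcases eq_or_lt_of_le ht.1 with h1 | h1
  · rw [← h1, h.left hT]
  rcases eq_or_lt_of_le ht.2 with h2 | h2
  · rw [h2, h.right]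
  exact e ⟨h1, h2⟩

/-- The zeros of a nonzero mode are simple. -/
theorem deriv_ne_zero (h : IsMode a j T f g) (ha : a ∈ Ioo (-1) 0 ∪ Ioi 0) (hT : 0 < T)
    (h0 : f 0 ≠ 0) {t : ℝ} (ht : t ∈ Ioo (-T) T) (hft : f t = 0) : g t ≠ 0 := fun hgt =>
  h0 <| linear_ode_unique (t₀ := t) (c := -T) (d := T) (abs_potential_le ha j)
    ht h.hasDerivAt h.hasDerivAt_deriv (g := fun _ => 0) (g' := fun _ => 0)
    (fun t _ => hasDerivAt_const _ _) (fun t _ => by simpa using hasDerivAt_const t (0 : ℝ))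
    hft hgt ⟨by linarith, hT⟩

/-- High modes vanish, since their potential `j² - 2 p_a` is nonnegative. -/
theorem eq_zero_of_le (h : IsMode a j T f g) (ha : a ∈ Ioo (-1) 0 ∪ Ioi 0) (hT : 0 < T)
    (hj : 2 * (1 + 2 * gam a) ≤ (j : ℝ) ^ 2) : ∀ t ∈ Icc (-T) T, f t = 0 :=
  eq_zero_of_positive_solution hT (q := fun _ => 0) (w := fun _ => 1) (w' := fun _ => 0)
    (fun _ _ => one_pos) continuousOn_const continuousOn_const
    (fun t _ => hasDerivAt_const t _) (fun t _ => by simpa using hasDerivAt_const t (0 : ℝ))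
    h.continuousOn h.continuousOn_deriv h.hasDerivAt h.hasDerivAt_deriv
    (fun t _ => by linarith [pa_le ha t]) (h.left hT) h.right

/-- For unduloids all modes but the zeroth vanish, by comparison with the positive function
`w_{a,1} = x - γ / x`. -/
theorem eq_zero_of_neg (h : IsMode a j T f g) (ha : a ∈ Ioo (-1) 0) (hT : 0 < T)
    (hj : 1 ≤ j) : ∀ t ∈ Icc (-T) T, f t = 0 := by
  have ha' : a ∈ Ioo (-1) 0 ∪ Ioi 0 := Or.inl ha
  have hw := isEvenSol_wa_one ha'
  have hj' : (1 : ℝ) ≤ (j : ℝ) ^ 2 := by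
    have : (1 : ℝ) ≤ j := by exact_mod_cast hj
    nlinarith
  refine eq_zero_of_positive_solution hT (fun t _ => ?_)
    (continuous_iff_continuousAt.2 fun t => (hw.hasDerivAt_deriv t).continuousAt).continuousOn
    hw.differentiable.continuous.continuousOn (fun t _ => hw.hasDerivAt t)
    (fun t _ => hw.hasDerivAt_deriv t) h.continuousOn h.continuousOn_deriv h.hasDerivAt
    h.hasDerivAt_deriv (fun t _ => ?_) (h.left hT) h.right
  · have hg : gam a < 0 := by rw [gam]; nlinarith [ha.1, ha.2]
    have := xa_pos ha' t
    rw [wa_one_eq ha']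
    have := div_neg_of_neg_of_pos hg this
    linarith
  · push_cast
    linarith

end IsMode

/-- The set of all `T > 0` for which `[-T, T]` carries a nonzero mode of order `j`. -/
def modeTimes (a : ℝ) (j : ℕ) : Set ℝ :=
  {T | 0 < T ∧ ∃ f g, IsMode a j T f g ∧ f 0 ≠ 0}

/-- Each point of `modeTimes a j` is isolated on its left or maximal: it is an interior zero of
the mode of any larger member, and the zeros of modes are simple. -/
theorem countable_modeTimes (ha : a ∈ Ioo (-1) 0 ∪ Ioi 0) (j : ℕ) :
    (modeTimes a j).Countable := by
  have hsub : modeTimes a j ⊆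
      {T | T ∈ modeTimes a j ∧ ∀ T' ∈ modeTimes a j, T' ≤ T} ∪
      {T | T ∈ modeTimes a j ∧ 𝓝[modeTimes a j ∩ Iio T] T = ⊥} := by
    intro T hT
    by_cases hmax : ∀ T' ∈ modeTimes a j, T' ≤ T
    · exact Or.inl ⟨hT, hmax⟩
    right
    push Not at hmax
    obtain ⟨T', hT', hlt⟩ := hmax
    obtain ⟨hT'0, f, g, hfg, hf0⟩ := hT'
    have hzero : ∀ S ∈ modeTimes a j, S ≤ T' → f S = 0 := by
      rintro S ⟨hS0, f₁, g₁, h₁, hf₁⟩ hSle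
      have e := h₁.eq_mul ha hS0 hfg hSle S ⟨by linarith, le_rfl⟩
      rw [h₁.right, mul_zero] at e
      exact (mul_eq_zero.1 e).resolve_left hf₁
    have hTI : T ∈ Ioo (-T') T' := ⟨by linarith [hT.1], hlt⟩
    have hne := (hfg.hasDerivAt T hTI).eventually_ne (c := 0)
      (hfg.deriv_ne_zero ha hT'0 hf0 hTI (hzero T hT hlt.le))
    refine ⟨hT, ?_⟩
    rw [← Filter.empty_mem_iff_bot]
    have hne' : ∀ᶠ S in 𝓝[modeTimes a j ∩ Iio T] T, f S ≠ 0 :=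
      hne.filter_mono (nhdsWithin_mono _ fun S hS => ne_of_lt hS.2)
    filter_upwards [hne', self_mem_nhdsWithin] with S h1 h2
    exact h1 (hzero S h2.1 (h2.2.le.trans hlt.le))
  refine Countable.mono hsub (Countable.union ?_ countable_setOfPred_isolated_left_within)
  refine Set.Subsingleton.countable fun S hS S' hS' => ?_
  exact le_antisymm (hS'.2 S hS.1) (hS.2 S' hS'.1)

end Modes

/-! ### Fourier coefficients in the angle -/

section Fourier

theorem lift_of_mem {I : Set ℝ} (φ : I × Real.Angle → ℝ) {t : ℝ} (ht : t ∈ I) (θ : ℝ) :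
    lift φ t θ = φ (⟨t, ht⟩, (θ : Real.Angle)) := dif_pos ht

theorem lift_add_two_pi {I : Set ℝ} (φ : I × Real.Angle → ℝ) (t θ : ℝ) :
    lift φ t (θ + 2 * Real.pi) = lift φ t θ := by
  simp only [lift, Real.Angle.coe_add, Real.Angle.coe_two_pi, add_zero]

theorem continuousOn_integral {c d : ℝ} (hcd : c ≤ d) {f : ℝ → ℝ → ℝ}
    (hf : ContinuousOn (fun p : ℝ × ℝ => f p.1 p.2) (Icc c d ×ˢ univ)) (u v : ℝ) :
    ContinuousOn (fun t => ∫ θ in u..v, f t θ) (Icc c d) := by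
  have h1 : Continuous (Function.uncurry fun t θ => f (projIcc c d hcd t) θ) :=
    hf.comp_continuous (f := fun p : ℝ × ℝ => ((projIcc c d hcd p.1 : ℝ), p.2))
      ((continuous_subtype_val.comp (continuous_projIcc.comp continuous_fst)).prodMk
        continuous_snd) fun p => ⟨Subtype.coe_prop _, mem_univ _⟩
  refine (intervalIntegral.continuous_parametric_intervalIntegral_of_continuous'
    (μ := MeasureTheory.volume) h1 u v).continuousOn.congr fun t ht => ?_
  simp only [projIcc_of_mem hcd ht]

theorem continuous_section {I : Set ℝ} {f : ℝ → ℝ → ℝ}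
    (hf : ContinuousOn (fun p : ℝ × ℝ => f p.1 p.2) (I ×ˢ univ)) {t : ℝ} (ht : t ∈ I) :
    Continuous (f t) :=
  hf.comp_continuous (f := fun θ : ℝ => (t, θ)) (by fun_prop) fun _ => ⟨ht, mem_univ _⟩

/-- Differentiation under the integral sign at interior points. -/
theorem hasDerivAt_integral {c d : ℝ} {f f' : ℝ → ℝ → ℝ}
    (hf : ContinuousOn (fun p : ℝ × ℝ => f p.1 p.2) (Icc c d ×ˢ univ))
    (hf' : ContinuousOn (fun p : ℝ × ℝ => f' p.1 p.2) (Icc c d ×ˢ univ))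
    (hd : ∀ t ∈ Icc c d, ∀ θ, HasDerivWithinAt (fun s => f s θ) (f' t θ) (Icc c d) t)
    (u v : ℝ) {t : ℝ} (ht : t ∈ Ioo c d) :
    HasDerivAt (fun t => ∫ θ in u..v, f t θ) (∫ θ in u..v, f' t θ) t := by
  obtain ⟨C, hC⟩ := (isCompact_Icc.prod
    (isCompact_uIcc (a := u) (b := v))).exists_bound_of_continuousOn (hf'.mono (prod_mono_right (subset_univ _)))
  have hnhds : Ioo c d ∈ 𝓝 t := Ioo_mem_nhds ht.1 ht.2
  refine (intervalIntegral.hasDerivAt_integral_of_dominated_loc_of_deriv_le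
    (bound := fun _ => C) hnhds ?_ ?_ ?_ ?_ ?_ ?_).2
  · filter_upwards [hnhds] with s hs
    exact (continuous_section hf (Ioo_subset_Icc_self hs)).aestronglyMeasurable
  · exact (continuous_section hf (Ioo_subset_Icc_self ht)).intervalIntegrable _ _
  · exact (continuous_section hf' (Ioo_subset_Icc_self ht)).aestronglyMeasurable
  · refine Filter.Eventually.of_forall fun θ hθ s hs => ?_
    exact hC (s, θ) ⟨Ioo_subset_Icc_self hs, uIoc_subset_uIcc hθ⟩
  · exact intervalIntegrable_const
  · refine Filter.Eventually.of_forall fun θ _ s hs => ?_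
    exact (hd s (Ioo_subset_Icc_self hs) θ).hasDerivAt (Icc_mem_nhds hs.1 hs.2)

/-- Two integrations by parts over a period. -/
theorem integral_deriv_deriv_mul {f f' f'' e e' : ℝ → ℝ} {c : ℝ}
    (hf : ∀ θ, HasDerivAt f (f' θ) θ) (hf' : ∀ θ, HasDerivAt f' (f'' θ) θ)
    (hf'' : Continuous f'') (hper : ∀ θ, f (θ + 2 * Real.pi) = f θ)
    (he : ∀ θ, HasDerivAt e (e' θ) θ) (he' : ∀ θ, HasDerivAt e' (c * e θ) θ)
    (hpe : e (2 * Real.pi) = e 0) (hpe' : e' (2 * Real.pi) = e' 0) :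
    ∫ θ in (0 : ℝ)..(2 * Real.pi), f'' θ * e θ =
      c * ∫ θ in (0 : ℝ)..(2 * Real.pi), f θ * e θ := by
  have cont : ∀ {k k' : ℝ → ℝ}, (∀ θ, HasDerivAt k (k' θ) θ) → Continuous k := fun h =>
    continuous_iff_continuousAt.2 fun θ => (h θ).continuousAt
  have hp0 : f (2 * Real.pi) = f 0 := by simpa using hper 0
  have hp1 : f' (2 * Real.pi) = f' 0 := by
    have e1 : HasDerivAt (fun θ => f (θ + 2 * Real.pi)) (f' (0 + 2 * Real.pi)) 0 :=
      (hf (0 + 2 * Real.pi)).comp_add_const 0 (2 * Real.pi)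
    rw [funext hper, zero_add] at e1
    exact e1.unique (hf 0)
  have i1 := intervalIntegral.integral_mul_deriv_eq_deriv_mul (u := e) (v := f')
    (a := 0) (b := 2 * Real.pi) (fun θ _ => he θ) (fun θ _ => hf' θ)
    ((cont he').intervalIntegrable _ _) (hf''.intervalIntegrable _ _)
  have i2 := intervalIntegral.integral_mul_deriv_eq_deriv_mul (u := e') (v := f)
    (a := 0) (b := 2 * Real.pi) (fun θ _ => he' θ) (fun θ _ => hf θ)
    (((cont he).const_mul c).intervalIntegrable _ _) ((cont hf').intervalIntegrable _ _)
  rw [hpe, hp1, sub_self, zero_sub] at i1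
  rw [hpe', hp0, sub_self, zero_sub] at i2
  simp only [mul_comm (f'' _), mul_comm (f _)]
  rw [i1, i2, neg_neg, ← intervalIntegral.integral_const_mul]
  simp only [mul_assoc]

/-- The Fourier coefficient of `φ(t, ·)` against the function `e`. -/
noncomputable def angularCoeff {I : Set ℝ} (e : ℝ → ℝ) (φ : I × Real.Angle → ℝ) (t : ℝ) : ℝ :=
  ∫ θ in (0 : ℝ)..(2 * Real.pi), lift φ t θ * e θ

/-- The Fourier coefficients of an element of the kernel are modes. -/
theorem exists_isMode {a : ℝ} (ha : a ∈ Ioo (-1) 0 ∪ Ioi 0) {α : ℝ≥0} {T : ℝ} (hT : 0 < T)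
    {φ : Icc (-T) T × Real.Angle → ℝ} (hφ : φ ∈ jacobiKer a α T) {j : ℕ} {e e' : ℝ → ℝ}
    (he : ∀ θ, HasDerivAt e (e' θ) θ) (he' : ∀ θ, HasDerivAt e' (-(j : ℝ) ^ 2 * e θ) θ)
    (hpe : e (2 * Real.pi) = e 0) (hpe' : e' (2 * Real.pi) = e' 0) :
    ∃ g, IsMode a j T (angularCoeff e φ) g := by
  have hTT : -T < T := by linarith
  obtain ⟨⟨⟨hC2, _⟩, hbd, heven⟩, hker⟩ := hφ
  have hI := uniqueDiffOn_Icc hTT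
  obtain ⟨φt, φh, φtt, φth, φhh, hP, ct, ctt, chh⟩ :=
    exists_hasPartials hI (X := lift φ) hC2
  have cφ := hC2.continuousOn
  have ce : Continuous e := continuous_iff_continuousAt.2 fun θ => (he θ).continuousAt
  have ceS : ContinuousOn (fun p : ℝ × ℝ => e p.2) (Icc (-T) T ×ˢ univ) :=
    (ce.comp continuous_snd).continuousOn
  refine ⟨fun t => ∫ θ in (0 : ℝ)..(2 * Real.pi), φt t θ * e θ,
    continuousOn_integral hTT.le (f := fun t θ => lift φ t θ * e θ) (cφ.mul ceS) _ _,
    continuousOn_integral hTT.le (f := fun t θ => φt t θ * e θ) (ct.mul ceS) _ _,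
    fun t ht => ?_, fun t ht => ?_, fun t ht => ?_, ?_⟩
  · exact hasDerivAt_integral (f := fun t θ => lift φ t θ * e θ)
      (f' := fun t θ => φt t θ * e θ) (cφ.mul ceS) (ct.mul ceS)
      (fun t ht θ => (hP.t t ht θ).mul_const _) _ _ ht
  · have ht' := Ioo_subset_Icc_self ht
    have h1 := hasDerivAt_integral (f := fun t θ => φt t θ * e θ)
      (f' := fun t θ => φtt t θ * e θ) (ct.mul ceS) (ctt.mul ceS)
      (fun t ht θ => (hP.tt t ht θ).mul_const _) 0 (2 * Real.pi) ht
    convert! h1 using 1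
    have h2 := integral_deriv_deriv_mul (hP.h t ht') (hP.hh t ht')
      (continuous_section chh ht') (lift_add_two_pi φ t) he he' hpe hpe'
    have h3 : ∀ θ, φtt t θ * e θ = -(φhh t θ * e θ) - 2 * pa a t * (lift φ t θ * e θ) :=
      fun θ => by
        have := (jacobi_eq_zero_iff ha hI hP ht' θ).1 (hker t ht' θ)
        linear_combination e θ * this
    simp only [h3]
    have i1 : IntervalIntegrable (fun θ => -(φhh t θ * e θ)) MeasureTheory.volume 0
        (2 * Real.pi) := ((continuous_section chh ht').mul ce).neg.intervalIntegrable _ _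
    have i2 : IntervalIntegrable (fun θ => 2 * pa a t * (lift φ t θ * e θ))
        MeasureTheory.volume 0 (2 * Real.pi) :=
      (continuous_const.mul ((continuous_section cφ ht').mul ce)).intervalIntegrable _ _
    rw [intervalIntegral.integral_sub i1 i2, intervalIntegral.integral_neg,
      h2, intervalIntegral.integral_const_mul, angularCoeff]
    ring
  · simp only [angularCoeff, heven t ht]
  · simp only [angularCoeff, (hbd _).1, zero_mul, intervalIntegral.integral_zero]

theorem hasDerivAt_cos_mul (k θ : ℝ) :
    HasDerivAt (fun θ => Real.cos (k * θ)) (-k * Real.sin (k * θ)) θ := by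
  convert! ((hasDerivAt_id θ).const_mul k).cos using 1
  simp
  ring

theorem hasDerivAt_sin_mul (k θ : ℝ) :
    HasDerivAt (fun θ => Real.sin (k * θ)) (k * Real.cos (k * θ)) θ := by
  convert! ((hasDerivAt_id θ).const_mul k).sin using 1
  simp
  ring

theorem exists_isMode_cos {a : ℝ} (ha : a ∈ Ioo (-1) 0 ∪ Ioi 0) {α : ℝ≥0} {T : ℝ} (hT : 0 < T)
    {φ : Icc (-T) T × Real.Angle → ℝ} (hφ : φ ∈ jacobiKer a α T) (j : ℕ) :
    ∃ g, IsMode a j T (angularCoeff (fun θ => Real.cos (j * θ)) φ) g := by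
  refine exists_isMode ha hT hφ (e' := fun θ => -(j : ℝ) * Real.sin (j * θ))
    (hasDerivAt_cos_mul j) (fun θ => ?_) ?_ ?_
  · convert! (hasDerivAt_sin_mul j θ).const_mul (-(j : ℝ)) using 1; ring
  · simp [Real.cos_nat_mul_two_pi]
  · have := Real.sin_nat_mul_pi (2 * j)
    push_cast at this
    rw [show (j : ℝ) * (2 * Real.pi) = 2 * j * Real.pi by ring, this]
    simp

theorem exists_isMode_sin {a : ℝ} (ha : a ∈ Ioo (-1) 0 ∪ Ioi 0) {α : ℝ≥0} {T : ℝ} (hT : 0 < T)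
    {φ : Icc (-T) T × Real.Angle → ℝ} (hφ : φ ∈ jacobiKer a α T) (j : ℕ) :
    ∃ g, IsMode a j T (angularCoeff (fun θ => Real.sin (j * θ)) φ) g := by
  refine exists_isMode ha hT hφ (e' := fun θ => (j : ℝ) * Real.cos (j * θ))
    (hasDerivAt_sin_mul j) (fun θ => ?_) ?_ ?_
  · convert! (hasDerivAt_cos_mul j θ).const_mul (j : ℝ) using 1; ring
  · have := Real.sin_nat_mul_pi (2 * j)
    push_cast at this
    rw [show (j : ℝ) * (2 * Real.pi) = 2 * j * Real.pi by ring, this]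
    simp
  · simp [Real.cos_nat_mul_two_pi]

/-- A continuous function on the circle whose Fourier coefficients all vanish is zero. -/
theorem eq_zero_of_fourier_eq_zero {f : Real.Angle → ℝ} (hf : Continuous fun θ : ℝ => f θ)
    (hc : ∀ n : ℕ, ∫ θ in (0 : ℝ)..(2 * Real.pi), f θ * Real.cos (n * θ) = 0)
    (hs : ∀ n : ℕ, ∫ θ in (0 : ℝ)..(2 * Real.pi), f θ * Real.sin (n * θ) = 0)
    (θ : Real.Angle) : f θ = 0 := by
  have : Fact (0 < 2 * Real.pi) := ⟨Real.two_pi_pos⟩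
  have hcont : Continuous f :=
    (QuotientAddGroup.isQuotientMap_mk (N := AddSubgroup.zmultiples (2 * Real.pi))).continuous_iff.2
      hf
  let F : C(AddCircle (2 * Real.pi), ℂ) :=
    ⟨fun u => ((f u : ℝ) : ℂ), Complex.continuous_ofReal.comp hcont⟩
  have hcZ : ∀ n : ℤ, ∫ θ in (0 : ℝ)..(2 * Real.pi), f θ * Real.cos (n * θ) = 0 := fun n => by
    obtain ⟨m, rfl | rfl⟩ := n.eq_nat_or_neg
    · exact_mod_cast hc m
    · simpa using hc m
  have hsZ : ∀ n : ℤ, ∫ θ in (0 : ℝ)..(2 * Real.pi), f θ * Real.sin (n * θ) = 0 := fun n => by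
    obtain ⟨m, rfl | rfl⟩ := n.eq_nat_or_neg
    · exact_mod_cast hs m
    · simpa using hs m
  have hcoef : ∀ n : ℤ, fourierCoeff F n = 0 := fun n => by
    have e0 : ∀ x : ℝ, (fourier (-n) (x : AddCircle (2 * Real.pi)) : ℂ) • F x =
        ((f x * Real.cos (n * x) : ℝ) : ℂ) + ((-(f x * Real.sin (n * x)) : ℝ) : ℂ) * Complex.I :=
      fun x => by
        have e1 : (fourier (-n) (x : AddCircle (2 * Real.pi)) : ℂ) =
            Real.cos (n * x) - Real.sin (n * x) * Complex.I := by
          rw [fourier_coe_apply]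
          have e2 : (2 * Real.pi * Complex.I * ((-n : ℤ) : ℂ) * x / ((2 * Real.pi : ℝ) : ℂ) : ℂ) =
              ((-(n * x) : ℝ) : ℂ) * Complex.I := by
            have : (Real.pi : ℂ) ≠ 0 := by exact_mod_cast Real.pi_ne_zero
            push_cast
            field_simp
          rw [e2, Complex.exp_mul_I, ← Complex.ofReal_cos, ← Complex.ofReal_sin, Real.cos_neg,
            Real.sin_neg]
          push_cast
          ring
        have e3 : F x = ((f x : ℝ) : ℂ) := rfl
        rw [e1, e3, smul_eq_mul]
        push_cast
        ring
    rw [fourierCoeff_eq_intervalIntegral F n 0, zero_add]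
    simp only [e0]
    have k1 : Continuous fun x : ℝ => f x * Real.cos (n * x) := by fun_prop
    have k2 : Continuous fun x : ℝ => f x * Real.sin (n * x) := by fun_prop
    have i1 : IntervalIntegrable (fun x : ℝ => ((f x * Real.cos (n * x) : ℝ) : ℂ))
        MeasureTheory.volume 0 (2 * Real.pi) :=
      (Complex.continuous_ofReal.comp k1).intervalIntegrable _ _
    have i2 : IntervalIntegrable
        (fun x : ℝ => ((-(f x * Real.sin (n * x)) : ℝ) : ℂ) * Complex.I)
        MeasureTheory.volume 0 (2 * Real.pi) :=
      ((Complex.continuous_ofReal.comp k2.neg).mul continuous_const).intervalIntegrable _ _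
    rw [intervalIntegral.integral_add i1 i2, intervalIntegral.integral_mul_const, intervalIntegral.integral_ofReal,
      intervalIntegral.integral_ofReal, intervalIntegral.integral_neg, hcZ, hsZ]
    simp
  have hsum := has_pointwise_sum_fourier_series_of_summable (f := F)
    (by rw [show fourierCoeff F = 0 from funext hcoef]; exact summable_zero) θ
  simp only [hcoef, zero_smul] at hsum
  have h0 : F θ = 0 := hsum.unique hasSum_zero
  exact Complex.ofReal_eq_zero.1 h0

end Fourier

/-! ### Elements of the Hölder space -/

section Holder

/-- The derivatives of a smooth function on `ℝ²` that is periodic in the second variable are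
bounded on `[c, d] × ℝ`. -/
theorem exists_norm_iteratedFDeriv_le {F : ℝ × ℝ → ℝ} {n m : ℕ} (hF : ContDiff ℝ n F)
    (hm : m ≤ n) (hper : ∀ p, F (p + (0, 2 * Real.pi)) = F p) (c d : ℝ) :
    ∃ C : ℝ≥0, ∀ p ∈ Icc c d ×ˢ (univ : Set ℝ), ‖iteratedFDeriv ℝ m F p‖ ≤ C := by
  have hcont := hF.continuous_iteratedFDeriv (m := m) (by exact_mod_cast hm)
  obtain ⟨C, hC⟩ := (isCompact_Icc (a := c) (b := d)).prod
    (isCompact_Icc (a := (0 : ℝ)) (b := 2 * Real.pi)) |>.exists_bound_of_continuousOn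
    hcont.continuousOn
  refine ⟨C.toNNReal, fun p hp => ?_⟩
  have hperD : ∀ t, Function.Periodic (fun θ => iteratedFDeriv ℝ m F (t, θ)) (2 * Real.pi) :=
    fun t θ => by
      have e := iteratedFDeriv_comp_add_right (𝕜 := ℝ) (f := F) m (0, 2 * Real.pi) (t, θ)
      rw [funext hper] at e
      simp only [Prod.mk_add_mk, add_zero] at e
      exact e.symm
  obtain ⟨y, hy, he⟩ := (hperD p.1).exists_mem_Ico₀ Real.two_pi_pos p.2
  have : iteratedFDeriv ℝ m F p = iteratedFDeriv ℝ m F (p.1, y) := he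
  rw [this]
  exact (hC (p.1, y) ⟨hp.1, Ico_subset_Icc_self hy⟩).trans (Real.le_coe_toNNReal C)

/-- A function of class `C³` on `ℝ²`, periodic in the second variable, restricts to a function
of class `C^{2,α}`: its second derivative is bounded and Lipschitz. -/
theorem isC2Holder_of_contDiff {α : ℝ≥0} (hα : α ≤ 1) {c d : ℝ} (hcd : c < d)
    {φ : Icc c d × Real.Angle → ℝ} {F : ℝ × ℝ → ℝ} (hF : ContDiff ℝ 3 F)
    (hper : ∀ p, F (p + (0, 2 * Real.pi)) = F p)
    (hφ : ∀ t ∈ Icc c d, ∀ θ, lift φ t θ = F (t, θ)) : IsC2Holder α φ := by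
  have hS : UniqueDiffOn ℝ (Icc c d ×ˢ (univ : Set ℝ)) :=
    (uniqueDiffOn_Icc hcd).prod uniqueDiffOn_univ
  have heq : EqOn (fun p : ℝ × ℝ => lift φ p.1 p.2) F (Icc c d ×ˢ univ) :=
    fun p hp => hφ p.1 hp.1 p.2
  have hF2 : ContDiff ℝ 2 F := hF.of_le (by norm_num)
  refine ⟨hF2.contDiffOn.congr heq, ?_⟩
  obtain ⟨B, hB⟩ := exists_norm_iteratedFDeriv_le (n := 3) (m := 2) hF (by norm_num) hper c d
  obtain ⟨K, hK⟩ := exists_norm_iteratedFDeriv_le (n := 3) (m := 3) hF le_rfl hper c d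
  have hLip : LipschitzOnWith K (iteratedFDeriv ℝ 2 F) (Icc c d ×ˢ univ) := by
    refine Convex.lipschitzOnWith_of_nnnorm_fderiv_le (𝕜 := ℝ)
      (fun p _ => hF.differentiable_iteratedFDeriv (m := 2) (by norm_num) p) (fun p hp => ?_)
      ((convex_Icc c d).prod convex_univ)
    rw [← NNReal.coe_le_coe, coe_nnnorm, norm_fderiv_iteratedFDeriv]
    exact hK p hp
  have hbdd : HolderOnWith (B + B) 0 (iteratedFDeriv ℝ 2 F) (Icc c d ×ˢ univ) := by
    intro p hp q hq
    rw [NNReal.coe_zero, ENNReal.rpow_zero, mul_one, edist_nndist, ENNReal.coe_le_coe,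
      ← NNReal.coe_le_coe, coe_nndist, NNReal.coe_add]
    exact (dist_le_norm_add_norm _ _).trans (add_le_add (hB p hp) (hB q hq))
  refine ⟨max (B + B) K, fun p hp q hq => ?_⟩
  have e : ∀ p ∈ Icc c d ×ˢ (univ : Set ℝ), iteratedFDerivWithin ℝ 2
      (fun p : ℝ × ℝ => lift φ p.1 p.2) (Icc c d ×ˢ univ) p = iteratedFDeriv ℝ 2 F p :=
    fun p hp => by
      rw [iteratedFDerivWithin_congr heq hp,
        iteratedFDerivWithin_eq_iteratedFDeriv hS hF2.contDiffAt hp]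
  rw [e p hp, e q hq]
  exact hbdd.of_le_of_le (holderOnWith_one.2 hLip) zero_le hα p hp q hq

theorem lift_add {I : Set ℝ} (φ ψ : I × Real.Angle → ℝ) :
    lift (φ + ψ) = lift φ + lift ψ := by
  funext t θ
  by_cases ht : t ∈ I <;> simp [lift, ht]

theorem lift_smul {I : Set ℝ} (c : ℝ) (φ : I × Real.Angle → ℝ) :
    lift (c • φ) = c • lift φ := by
  funext t θ
  by_cases ht : t ∈ I <;> simp [lift, ht]

variable {α : ℝ≥0} {c d : ℝ} {φ ψ : Icc c d × Real.Angle → ℝ}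

theorem IsC2Holder.add (hcd : c < d) (hφ : IsC2Holder α φ) (hψ : IsC2Holder α ψ) :
    IsC2Holder α (φ + ψ) := by
  have hS : UniqueDiffOn ℝ (Icc c d ×ˢ (univ : Set ℝ)) :=
    (uniqueDiffOn_Icc hcd).prod uniqueDiffOn_univ
  obtain ⟨h1, C, hC⟩ := hφ
  obtain ⟨h2, D, hD⟩ := hψ
  have e : (fun p : ℝ × ℝ => lift (φ + ψ) p.1 p.2) =
      (fun p : ℝ × ℝ => lift φ p.1 p.2) + fun p : ℝ × ℝ => lift ψ p.1 p.2 := by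
    rw [lift_add]; rfl
  rw [IsC2Holder, e]
  refine ⟨h1.add h2, C + D, fun p hp q hq => ?_⟩
  rw [iteratedFDerivWithin_add_apply (h1 p hp) (h2 p hp) hS hp,
    iteratedFDerivWithin_add_apply (h1 q hq) (h2 q hq) hS hq, ENNReal.coe_add, add_mul]
  exact (edist_add_add_le _ _ _ _).trans (add_le_add (hC p hp q hq) (hD p hp q hq))

theorem IsC2Holder.smul (hcd : c < d) (k : ℝ) (hφ : IsC2Holder α φ) : IsC2Holder α (k • φ) := by
  have hS : UniqueDiffOn ℝ (Icc c d ×ˢ (univ : Set ℝ)) :=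
    (uniqueDiffOn_Icc hcd).prod uniqueDiffOn_univ
  obtain ⟨h1, C, hC⟩ := hφ
  have e : (fun p : ℝ × ℝ => lift (k • φ) p.1 p.2) =
      k • fun p : ℝ × ℝ => lift φ p.1 p.2 := by
    rw [lift_smul]; rfl
  rw [IsC2Holder, e]
  refine ⟨h1.const_smul k, ‖k‖₊ * C, fun p hp q hq => ?_⟩
  rw [iteratedFDerivWithin_const_smul_apply (h1 p hp) hS hp,
    iteratedFDerivWithin_const_smul_apply (h1 q hq) hS hq, ENNReal.coe_mul, mul_assoc]
  have hs := edist_smul_le k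
    (iteratedFDerivWithin ℝ 2 (fun p : ℝ × ℝ => lift φ p.1 p.2) (Icc c d ×ˢ univ) p)
    (iteratedFDerivWithin ℝ 2 (fun p : ℝ × ℝ => lift φ p.1 p.2) (Icc c d ×ˢ univ) q)
  refine hs.trans ?_
  rw [ENNReal.smul_def, smul_eq_mul]
  exact mul_le_mul_right (hC p hp q hq) _

end Holder

/-! ### The kernel -/

section Kernel

variable {a : ℝ} {α : ℝ≥0} {T : ℝ}

/-- The product of a function of `t` and a function of `θ`. -/
theorem hasPartials_mul (I : Set ℝ) {f f' f'' e e' e'' : ℝ → ℝ} (hf : ∀ t, HasDerivAt f (f' t) t)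
    (hf' : ∀ t, HasDerivAt f' (f'' t) t) (he : ∀ θ, HasDerivAt e (e' θ) θ)
    (he' : ∀ θ, HasDerivAt e' (e'' θ) θ) :
    HasPartials I (fun t θ => f t * e θ) (fun t θ => f' t * e θ) (fun t θ => f t * e' θ)
      (fun t θ => f'' t * e θ) (fun t θ => f' t * e' θ) (fun t θ => f t * e'' θ) where
  t t _ _ := ((hf t).mul_const _).hasDerivWithinAt
  h _ _ θ := (he θ).const_mul _
  tt t _ _ := ((hf' t).mul_const _).hasDerivWithinAt
  th _ _ θ := (he θ).const_mul _
  hh _ _ θ := (he' θ).const_mul _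

theorem add_mem_jacobiKer (ha : a ∈ Ioo (-1) 0 ∪ Ioi 0) (hT : 0 < T)
    {φ ψ : Icc (-T) T × Real.Angle → ℝ} (hφ : φ ∈ jacobiKer a α T) (hψ : ψ ∈ jacobiKer a α T) :
    φ + ψ ∈ jacobiKer a α T := by
  have hTT : -T < T := by linarith
  have hI := uniqueDiffOn_Icc hTT
  obtain ⟨⟨h1, h2, h3⟩, h4⟩ := hφ
  obtain ⟨⟨k1, k2, k3⟩, k4⟩ := hψ
  refine ⟨⟨h1.add hTT k1, fun θ => ?_, fun t ht θ => ?_⟩, fun t ht θ => ?_⟩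
  · simp [lift_add, h2, k2]
  · simp [lift_add, h3 t ht, k3 t ht]
  · obtain ⟨_, _, _, _, _, hP, -⟩ := exists_hasPartials hI (X := lift φ) h1.1
    obtain ⟨_, _, _, _, _, hQ, -⟩ := exists_hasPartials hI (X := lift ψ) k1.1
    have e1 := (jacobi_eq_zero_iff ha hI hP ht θ).1 (h4 t ht θ)
    have e2 := (jacobi_eq_zero_iff ha hI hQ ht θ).1 (k4 t ht θ)
    rw [lift_add, jacobi_eq_zero_iff ha hI (hP.add hQ) ht θ]
    simp only [Pi.add_apply]
    linear_combination e1 + e2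

theorem smul_mem_jacobiKer (ha : a ∈ Ioo (-1) 0 ∪ Ioi 0) (hT : 0 < T) (c : ℝ)
    {φ : Icc (-T) T × Real.Angle → ℝ} (hφ : φ ∈ jacobiKer a α T) : c • φ ∈ jacobiKer a α T := by
  have hTT : -T < T := by linarith
  have hI := uniqueDiffOn_Icc hTT
  obtain ⟨⟨h1, h2, h3⟩, h4⟩ := hφ
  refine ⟨⟨h1.smul hTT c, fun θ => ?_, fun t ht θ => ?_⟩, fun t ht θ => ?_⟩
  · simp [lift_smul, h2]
  · simp [lift_smul, h3 t ht]
  · obtain ⟨_, _, _, _, _, hP, -⟩ := exists_hasPartials hI (X := lift φ) h1.1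
    have e1 := (jacobi_eq_zero_iff ha hI hP ht θ).1 (h4 t ht θ)
    rw [lift_smul, jacobi_eq_zero_iff ha hI (hP.const_smul c) ht θ]
    simp only [Pi.smul_apply, smul_eq_mul]
    linear_combination c * e1

/-- Products of an even solution that vanishes at `T` and of a trigonometric function belong to
the kernel. -/
theorem mul_mem_jacobiKer (ha : a ∈ Ioo (-1) 0 ∪ Ioi 0) (hα : α ≤ 1) (hT : 0 < T) {j : ℕ}
    {u : ℝ → ℝ} (hu : IsEvenSol a j u) (huT : u T = 0) {e e' : ℝ → ℝ} (hec : ContDiff ℝ 3 e)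
    (hper : ∀ θ, e (θ + 2 * Real.pi) = e θ) (he : ∀ θ, HasDerivAt e (e' θ) θ)
    (he' : ∀ θ, HasDerivAt e' (-(j : ℝ) ^ 2 * e θ) θ) {E : Real.Angle → ℝ}
    (hE : ∀ θ : ℝ, E θ = e θ) :
    (fun p : Icc (-T) T × Real.Angle => u p.1 * E p.2) ∈ jacobiKer a α T := by
  have hTT : -T < T := by linarith
  have hI := uniqueDiffOn_Icc hTT
  have hlift : ∀ t ∈ Icc (-T) T, ∀ θ, lift (fun p : Icc (-T) T × Real.Angle => u p.1 * E p.2) t θ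
      = u t * e θ := fun t ht θ => by rw [lift_of_mem _ ht, hE]
  have hneg : ∀ t ∈ Icc (-T) T, -t ∈ Icc (-T) T := fun t ht =>
    ⟨by linarith [ht.2], by linarith [ht.1]⟩
  have hTm : T ∈ Icc (-T) T := ⟨hTT.le, le_rfl⟩
  refine ⟨⟨isC2Holder_of_contDiff hα hTT (F := fun p => u p.1 * e p.2) ?_ (fun p => ?_) hlift,
    fun θ => ⟨?_, ?_⟩, fun t ht θ => ?_⟩, fun t ht θ => ?_⟩
  · exact ((hu.contDiff ha).comp contDiff_fst).mul (hec.comp contDiff_snd)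
  · simp [hper]
  · rw [hlift T hTm, huT, zero_mul]
  · rw [hlift (-T) (hneg T hTm), hu.even ha, huT, zero_mul]
  · rw [hlift t ht, hlift (-t) (hneg t ht), hu.even ha]
  · rw [jacobi_eq_zero_iff ha hI
      ((hasPartials_mul _ hu.hasDerivAt hu.hasDerivAt_deriv he he').congr hlift) ht,
      hlift t ht]
    ring

/-- The members of `𝒯_{a,j}` are the positive zeros of the even solution of order `j`. -/
theorem mem_nodalTimes_iff (ha : a ∈ Ioo (-1) 0 ∪ Ioi 0) {j : ℕ} {u : ℝ → ℝ}
    (hu : IsEvenSol a j u) {T : ℝ} : T ∈ nodalTimes a j ↔ 0 < T ∧ u T = 0 := by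
  have he := hasDerivAt_cos_mul (j : ℝ)
  have he' : ∀ θ : ℝ, HasDerivAt (fun θ : ℝ => -(j : ℝ) * Real.sin (j * θ))
      (-(j : ℝ) ^ 2 * Real.cos (j * θ)) θ := fun θ => by
    convert! (hasDerivAt_sin_mul j θ).const_mul (-(j : ℝ)) using 1; ring
  have hsgn : (-1 : ℝ) ^ (j + 1) ≠ 0 := pow_ne_zero _ (by norm_num)
  constructor
  · rintro ⟨hT, w, φ, heven, hφ, hC2, hne, hjac, hφT⟩
    have hφ' : φ = fun t θ => w t * Real.cos (j * θ) := funext fun t => funext fun θ => hφ t θ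
    have hw2 : ContDiff ℝ (1 + 1) w := by
      have h1 : ContDiff ℝ 2 fun t : ℝ => φ t 0 :=
        hC2.comp (contDiff_id.prodMk contDiff_const)
      simpa [hφ, one_add_one_eq_two] using h1
    have hw1 := (contDiff_succ_iff_deriv.1 hw2).2.2
    have hd : ∀ t, HasDerivAt w (deriv w t) t := fun t =>
      (hw2.differentiable (by simp) t).hasDerivAt
    have hd' : ∀ t, HasDerivAt (deriv w) (deriv (deriv w) t) t := fun t =>
      (hw1.differentiable (by simp) t).hasDerivAt
    have hode : ∀ t, deriv (deriv w) t = ((j : ℝ) ^ 2 - 2 * pa a t) * w t := fun t => by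
      have e := hjac t 0
      rw [hφ', jacobi_eq_zero_iff ha uniqueDiffOn_univ
        (hasPartials_mul univ hd hd' he he') (mem_univ t)] at e
      simp only [mul_zero, Real.cos_zero, mul_one] at e
      linarith
    have hw0 : deriv w 0 = 0 :=
      deriv_eq_zero_of_even (hd 0) (Filter.Eventually.of_forall heven)
    have key := hu.eq_of_global ha hd (fun t => by rw [← hode]; exact hd' t) hw0
    have hwT : w T = 0 := by simpa [hφ] using hφT 0
    have hw00 : w 0 ≠ 0 := fun h0 => hne <| by
      rw [hφ']
      funext t θ
      rw [key t, h0]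
      simp
    refine ⟨hT, ?_⟩
    rw [key T] at hwT
    exact (mul_eq_zero.1 hwT).resolve_left (mul_ne_zero hsgn hw00)
  · rintro ⟨hT, huT⟩
    refine ⟨hT, u, fun t θ => u t * Real.cos (j * θ), hu.even ha, fun _ _ => rfl, ?_, ?_, ?_, ?_⟩
    · exact (((hu.contDiff ha).of_le (by norm_num)).comp contDiff_fst).mul
        (Real.contDiff_cos.comp (contDiff_const.mul contDiff_snd))
    · intro h0
      have := congrFun (congrFun h0 0) 0
      simp [hu.zero] at this
    · intro t θ
      rw [jacobi_eq_zero_iff ha uniqueDiffOn_univ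
        (hasPartials_mul univ hu.hasDerivAt hu.hasDerivAt_deriv he he') (mem_univ t)]
      ring
    · intro θ
      simp [huT]

theorem zero_mem_jacobiKer (ha : a ∈ Ioo (-1) 0 ∪ Ioi 0) (hT : 0 < T) :
    (0 : Icc (-T) T × Real.Angle → ℝ) ∈ jacobiKer a α T := by
  have hTT : -T < T := by linarith
  have hl : lift (0 : Icc (-T) T × Real.Angle → ℝ) = fun _ _ => 0 * 0 := by
    funext t θ; simp [lift]
  refine ⟨⟨⟨?_, 0, ?_⟩, ?_, ?_⟩, fun t ht θ => ?_⟩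
  · simpa [hl] using contDiffOn_const
  · simp only [hl, mul_zero]
    intro p _ q _
    rw [iteratedFDerivWithin_fun_zero]
    simp
  · simp [hl]
  · simp [hl]
  · have hz : ∀ t : ℝ, HasDerivAt (fun _ : ℝ => (0 : ℝ)) 0 t := fun t => hasDerivAt_const t _
    rw [hl, jacobi_eq_zero_iff ha (uniqueDiffOn_Icc hTT) (hasPartials_mul _ hz hz hz hz) ht θ]
    simp

/-- The kernel of the Jacobi operator in `𝒳_T` as a linear subspace. -/
def kerSubmodule (ha : a ∈ Ioo (-1) 0 ∪ Ioi 0) (α : ℝ≥0) (hT : 0 < T) :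
    Submodule ℝ (Icc (-T) T × Real.Angle → ℝ) where
  carrier := jacobiKer a α T
  add_mem' := add_mem_jacobiKer ha hT
  zero_mem' := zero_mem_jacobiKer ha hT
  smul_mem' c _ := smul_mem_jacobiKer ha hT c

theorem angularCoeff_add {e : ℝ → ℝ} (he : Continuous e)
    {φ ψ : Icc (-T) T × Real.Angle → ℝ} (hφ : φ ∈ jacobiKer a α T) (hψ : ψ ∈ jacobiKer a α T)
    {t : ℝ} (ht : t ∈ Icc (-T) T) :
    angularCoeff e (φ + ψ) t = angularCoeff e φ t + angularCoeff e ψ t := by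
  have i1 : IntervalIntegrable (fun θ => lift φ t θ * e θ) MeasureTheory.volume 0 (2 * Real.pi) :=
    ((continuous_section hφ.1.1.1.continuousOn ht).mul he).intervalIntegrable _ _
  have i2 : IntervalIntegrable (fun θ => lift ψ t θ * e θ) MeasureTheory.volume 0 (2 * Real.pi) :=
    ((continuous_section hψ.1.1.1.continuousOn ht).mul he).intervalIntegrable _ _
  simp only [angularCoeff, lift_add, Pi.add_apply, add_mul]
  exact intervalIntegral.integral_add i1 i2

theorem angularCoeff_smul (e : ℝ → ℝ) (c : ℝ) (φ : Icc (-T) T × Real.Angle → ℝ) (t : ℝ) :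
    angularCoeff e (c • φ) t = c * angularCoeff e φ t := by
  simp only [angularCoeff, lift_smul, Pi.smul_apply, smul_eq_mul, mul_assoc]
  exact intervalIntegral.integral_const_mul _ _

/-- An element of the kernel is determined by its Fourier coefficients on the circle `t = 0`. -/
theorem eq_zero_of_angularCoeff (ha : a ∈ Ioo (-1) 0 ∪ Ioi 0) (hT : 0 < T)
    {φ : Icc (-T) T × Real.Angle → ℝ} (hφ : φ ∈ jacobiKer a α T)
    (hc : ∀ j : ℕ, angularCoeff (fun θ => Real.cos (j * θ)) φ 0 = 0)
    (hs : ∀ j : ℕ, angularCoeff (fun θ => Real.sin (j * θ)) φ 0 = 0) : φ = 0 := by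
  funext p
  obtain ⟨⟨t, ht⟩, θ⟩ := p
  have hl : ∀ θ : ℝ, lift φ t θ = φ (⟨t, ht⟩, θ) := lift_of_mem φ ht
  refine eq_zero_of_fourier_eq_zero (f := fun θ => φ (⟨t, ht⟩, θ)) ?_ (fun n => ?_)
    (fun n => ?_) θ
  · exact (continuous_section hφ.1.1.1.continuousOn ht).congr hl
  · obtain ⟨g, hg⟩ := exists_isMode_cos ha hT hφ n
    simpa only [angularCoeff, hl] using hg.eq_zero ha hT (hc n) t ht
  · obtain ⟨g, hg⟩ := exists_isMode_sin ha hT hφ n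
    simpa only [angularCoeff, hl] using hg.eq_zero ha hT (hs n) t ht

/-- The kernel is finite-dimensional: its elements are determined by finitely many Fourier
coefficients, as high modes vanish. -/
theorem finiteDimensional_kerSubmodule (ha : a ∈ Ioo (-1) 0 ∪ Ioi 0) (α : ℝ≥0) (hT : 0 < T) :
    FiniteDimensional ℝ (kerSubmodule ha α hT) := by
  obtain ⟨J, hJ⟩ := exists_nat_ge (2 * (1 + 2 * gam a))
  have h0 : (0 : ℝ) ∈ Icc (-T) T := ⟨by linarith, hT.le⟩
  have hJ' : ∀ j : ℕ, J ≤ j → 2 * (1 + 2 * gam a) ≤ (j : ℝ) ^ 2 := fun j hj => by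
    have h1 : (J : ℝ) ≤ j := by exact_mod_cast hj
    have h2 : j ≤ j ^ 2 := Nat.le_self_pow (by norm_num) j
    have h3 : (j : ℝ) ≤ (j : ℝ) ^ 2 := by exact_mod_cast h2
    linarith
  let L : kerSubmodule ha α hT →ₗ[ℝ] (Fin J → ℝ × ℝ) :=
    { toFun := fun φ j => (angularCoeff (fun θ => Real.cos ((j : ℕ) * θ)) φ.1 0,
        angularCoeff (fun θ => Real.sin ((j : ℕ) * θ)) φ.1 0)
      map_add' := fun φ ψ => by
        funext j
        have hcc : Continuous fun θ : ℝ => Real.cos ((j : ℕ) * θ) := by fun_prop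
        have hcs : Continuous fun θ : ℝ => Real.sin ((j : ℕ) * θ) := by fun_prop
        exact Prod.ext (angularCoeff_add hcc φ.2 ψ.2 h0) (angularCoeff_add hcs φ.2 ψ.2 h0)
      map_smul' := fun c φ => by
        funext j
        exact Prod.ext (angularCoeff_smul _ c φ.1 0) (angularCoeff_smul _ c φ.1 0) }
  refine Module.Finite.of_injective L ((injective_iff_map_eq_zero L).2 fun φ hφ => ?_)
  refine Subtype.ext (eq_zero_of_angularCoeff ha hT φ.2 (fun j => ?_) (fun j => ?_))
  · rcases lt_or_ge j J with hj | hj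
    · exact congrArg Prod.fst (congrFun hφ ⟨j, hj⟩)
    · obtain ⟨g, hg⟩ := exists_isMode_cos ha hT φ.2 j
      exact hg.eq_zero_of_le ha hT (hJ' j hj) 0 h0
  · rcases lt_or_ge j J with hj | hj
    · exact congrArg Prod.snd (congrFun hφ ⟨j, hj⟩)
    · obtain ⟨g, hg⟩ := exists_isMode_sin ha hT φ.2 j
      exact hg.eq_zero_of_le ha hT (hJ' j hj) 0 h0

/-- The kernel is trivial if `[-T, T]` carries no nonzero modes. -/
theorem jacobiKer_eq_zero (ha : a ∈ Ioo (-1) 0 ∪ Ioi 0) (hT : 0 < T)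
    (h : ∀ j f g, IsMode a j T f g → f 0 = 0) : jacobiKer a α T = {0} := by
  refine Subset.antisymm (fun φ hφ => ?_) (singleton_subset_iff.2 (zero_mem_jacobiKer ha hT))
  refine eq_zero_of_angularCoeff ha hT hφ (fun j => ?_) (fun j => ?_)
  · obtain ⟨g, hg⟩ := exists_isMode_cos ha hT hφ j
    exact h j _ g hg
  · obtain ⟨g, hg⟩ := exists_isMode_sin ha hT hφ j
    exact h j _ g hg

theorem countable_jacobiKer_ne (ha : a ∈ Ioo (-1) 0 ∪ Ioi 0) (α : ℝ≥0) :
    {T : ℝ | 0 < T ∧ jacobiKer a α T ≠ {0}}.Countable := by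
  refine (countable_iUnion (countable_modeTimes ha)).mono fun T hT => ?_
  by_contra hn
  simp only [mem_iUnion, not_exists] at hn
  refine hT.2 (jacobiKer_eq_zero ha hT.1 fun j f g hfg => ?_)
  by_contra h0
  exact hn j ⟨hT.1, f, g, hfg, h0⟩

theorem jacobiKer_ne_zero_of_mem {φ : Icc (-T) T × Real.Angle → ℝ} (hφ : φ ∈ jacobiKer a α T)
    {p : Icc (-T) T × Real.Angle} (hp : φ p ≠ 0) : jacobiKer a α T ≠ {0} := fun h => by
  rw [h] at hφ
  exact hp (congrFun hφ p)

theorem wa_zero_mem (ha : a ∈ Ioo (-1) 0 ∪ Ioi 0) (hα : α ≤ 1) (hT : 0 < T)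
    (h0 : wa a 0 T = 0) :
    (fun p : Icc (-T) T × Real.Angle => wa a 0 p.1) ∈ jacobiKer a α T := by
  have := mul_mem_jacobiKer ha hα hT (isEvenSol_wa_zero ha) h0 (e := fun _ => 1)
    (e' := fun _ => 0) contDiff_const (fun _ => rfl) (fun θ => hasDerivAt_const θ _)
    (fun θ => by simpa using hasDerivAt_const θ (0 : ℝ)) (E := fun _ => 1) (fun _ => rfl)
  simpa using this

theorem wa_one_cos_mem (ha : a ∈ Ioo (-1) 0 ∪ Ioi 0) (hα : α ≤ 1) (hT : 0 < T)
    (h1 : wa a 1 T = 0) :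
    (fun p : Icc (-T) T × Real.Angle => wa a 1 p.1 * p.2.cos) ∈ jacobiKer a α T :=
  mul_mem_jacobiKer ha hα hT (isEvenSol_wa_one ha) h1 (e := Real.cos)
    (e' := fun θ => -Real.sin θ) Real.contDiff_cos Real.cos_add_two_pi Real.hasDerivAt_cos
    (fun θ => by simpa [Pi.neg_def] using (Real.hasDerivAt_sin θ).neg) Real.Angle.cos_coe

theorem wa_one_sin_mem (ha : a ∈ Ioo (-1) 0 ∪ Ioi 0) (hα : α ≤ 1) (hT : 0 < T)
    (h1 : wa a 1 T = 0) :
    (fun p : Icc (-T) T × Real.Angle => wa a 1 p.1 * p.2.sin) ∈ jacobiKer a α T :=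
  mul_mem_jacobiKer ha hα hT (isEvenSol_wa_one ha) h1 (e := Real.sin)
    (e' := Real.cos) Real.contDiff_sin Real.sin_add_two_pi Real.hasDerivAt_sin
    (fun θ => by simpa using Real.hasDerivAt_cos θ) Real.Angle.sin_coe

/-- If all modes but the zeroth vanish, subtracting a multiple of `w_{a,0}` from an element of the
kernel removes all its Fourier coefficients. -/
theorem jacobiKer_eq_span_zero (ha : a ∈ Ioo (-1) 0 ∪ Ioi 0) (hα : α ≤ 1) (hT : 0 < T)
    (h : ∀ j f g, j ≠ 0 → IsMode a j T f g → f 0 = 0) (h0 : wa a 0 T = 0) :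
    jacobiKer a α T =
      Submodule.span ℝ {fun p : Icc (-T) T × Real.Angle => wa a 0 p.1} := by
  set ω : Icc (-T) T × Real.Angle → ℝ := fun p => wa a 0 p.1 with hω
  have hωm : ω ∈ jacobiKer a α T := wa_zero_mem ha hα hT h0
  have hm0 : (0 : ℝ) ∈ Icc (-T) T := ⟨by linarith, hT.le⟩
  refine Subset.antisymm (fun φ hφ => ?_) ?_
  · have hωc : angularCoeff (fun θ => Real.cos ((0 : ℕ) * θ)) ω 0 = -(2 * Real.pi) := by
      have : ∀ θ : ℝ, lift ω 0 θ = -1 := fun θ => by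
        rw [lift_of_mem _ hm0]
        simp [hω, (isEvenSol_wa_zero ha).zero]
      simp [angularCoeff, this]
    set c := angularCoeff (fun θ => Real.cos ((0 : ℕ) * θ)) φ 0 / (2 * Real.pi) with hc
    have hψ : φ + c • ω ∈ jacobiKer a α T :=
      add_mem_jacobiKer ha hT hφ (smul_mem_jacobiKer ha hT c hωm)
    have hz : φ + c • ω = 0 := by
      refine eq_zero_of_angularCoeff ha hT hψ (fun j => ?_) (fun j => ?_)
      · rcases eq_or_ne j 0 with rfl | hj
        · rw [angularCoeff_add (by fun_prop) hφ (smul_mem_jacobiKer ha hT c hωm) hm0,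
            angularCoeff_smul, hωc, hc]
          field_simp
          ring
        · obtain ⟨g, hg⟩ := exists_isMode_cos ha hT hψ j
          exact h j _ g hj hg
      · rcases eq_or_ne j 0 with rfl | hj
        · simp [angularCoeff]
        · obtain ⟨g, hg⟩ := exists_isMode_sin ha hT hψ j
          exact h j _ g hj hg
    rw [SetLike.mem_coe, Submodule.mem_span_singleton]
    exact ⟨-c, by rw [neg_smul]; exact (eq_neg_of_add_eq_zero_left hz).symm⟩
  · exact (Submodule.span_le (p := kerSubmodule ha α hT)).2 (singleton_subset_iff.2 hωm)

/-- The same for the first mode, which carries a cosine and a sine coefficient. -/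
theorem jacobiKer_eq_span_one (ha : a ∈ Ioo (-1) 0 ∪ Ioi 0) (hα : α ≤ 1) (hT : 0 < T)
    (h : ∀ j f g, j ≠ 1 → IsMode a j T f g → f 0 = 0) (h1 : wa a 1 T = 0) :
    jacobiKer a α T =
      Submodule.span ℝ {fun p : Icc (-T) T × Real.Angle => wa a 1 p.1 * p.2.cos,
        fun p => wa a 1 p.1 * p.2.sin} := by
  set ω : Icc (-T) T × Real.Angle → ℝ := fun p => wa a 1 p.1 * p.2.cos with hω
  set η : Icc (-T) T × Real.Angle → ℝ := fun p => wa a 1 p.1 * p.2.sin with hη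
  have hωm : ω ∈ jacobiKer a α T := wa_one_cos_mem ha hα hT h1
  have hηm : η ∈ jacobiKer a α T := wa_one_sin_mem ha hα hT h1
  have hm0 : (0 : ℝ) ∈ Icc (-T) T := ⟨by linarith, hT.le⟩
  refine Subset.antisymm (fun φ hφ => ?_) ?_
  · have hωl : ∀ θ : ℝ, lift ω 0 θ = Real.cos θ := fun θ => by
      rw [lift_of_mem _ hm0]
      simp [hω, (isEvenSol_wa_one ha).zero]
    have hηl : ∀ θ : ℝ, lift η 0 θ = Real.sin θ := fun θ => by
      rw [lift_of_mem _ hm0]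
      simp [hη, (isEvenSol_wa_one ha).zero]
    have ic : ∫ θ in (0 : ℝ)..(2 * Real.pi), Real.cos θ * Real.cos θ = Real.pi := by
      simp only [← pow_two]
      rw [integral_cos_sq]
      simp
    have is : ∫ θ in (0 : ℝ)..(2 * Real.pi), Real.sin θ * Real.sin θ = Real.pi := by
      simp only [← pow_two]
      rw [integral_sin_sq]
      simp
    have isc : ∫ θ in (0 : ℝ)..(2 * Real.pi), Real.sin θ * Real.cos θ = 0 := by
      rw [integral_sin_mul_cos₁]
      simp
    set c := angularCoeff (fun θ => Real.cos ((1 : ℕ) * θ)) φ 0 / Real.pi with hc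
    set d := angularCoeff (fun θ => Real.sin ((1 : ℕ) * θ)) φ 0 / Real.pi with hd
    have hcω := smul_mem_jacobiKer ha hT (-c) hωm
    have hdη := smul_mem_jacobiKer ha hT (-d) hηm
    have hsum := add_mem_jacobiKer ha hT hφ hcω
    have hψ := add_mem_jacobiKer ha hT hsum hdη
    have hz : φ + (-c) • ω + (-d) • η = 0 := by
      refine eq_zero_of_angularCoeff ha hT hψ (fun j => ?_) (fun j => ?_)
      · rcases eq_or_ne j 1 with rfl | hj
        · rw [angularCoeff_add (by fun_prop) hsum hdη hm0,
            angularCoeff_add (by fun_prop) hφ hcω hm0, angularCoeff_smul, angularCoeff_smul]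
          have e1 : angularCoeff (fun θ => Real.cos ((1 : ℕ) * θ)) ω 0 = Real.pi := by
            simp only [angularCoeff, hωl, Nat.cast_one, one_mul, ic]
          have e2 : angularCoeff (fun θ => Real.cos ((1 : ℕ) * θ)) η 0 = 0 := by
            simp only [angularCoeff, hηl, Nat.cast_one, one_mul, isc]
          rw [e1, e2, hc]
          have := Real.pi_ne_zero
          field_simp
          ring
        · obtain ⟨g, hg⟩ := exists_isMode_cos ha hT hψ j
          exact h j _ g hj hg
      · rcases eq_or_ne j 1 with rfl | hj
        · rw [angularCoeff_add (by fun_prop) hsum hdη hm0,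
            angularCoeff_add (by fun_prop) hφ hcω hm0, angularCoeff_smul, angularCoeff_smul]
          have e1 : angularCoeff (fun θ => Real.sin ((1 : ℕ) * θ)) ω 0 = 0 := by
            simp only [angularCoeff, hωl, Nat.cast_one, one_mul]
            simpa only [mul_comm] using isc
          have e2 : angularCoeff (fun θ => Real.sin ((1 : ℕ) * θ)) η 0 = Real.pi := by
            simp only [angularCoeff, hηl, Nat.cast_one, one_mul, is]
          rw [e1, e2, hd]
          have := Real.pi_ne_zero
          field_simp
          ring
        · obtain ⟨g, hg⟩ := exists_isMode_sin ha hT hψ j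
          exact h j _ g hj hg
    rw [SetLike.mem_coe, Submodule.mem_span_pair]
    refine ⟨c, d, ?_⟩
    rw [neg_smul, neg_smul] at hz
    have e : φ - (c • ω + d • η) = 0 := by rw [← hz]; abel
    exact (sub_eq_zero.1 e).symm
  · exact (Submodule.span_le (p := kerSubmodule ha α hT)).2
      (insert_subset_iff.2 ⟨hωm, singleton_subset_iff.2 hηm⟩)

end Kernel

end Delaunay

open Delaunay in
theorem corollary3p3 (a : ℝ) (ha : a ∈ Set.Ioo (-1) 0 ∪ Set.Ioi 0)
    (α : NNReal) (hα0 : 0 < α) (hα1 : α < 1) :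
    (∀ T : ℝ, 0 < T → ∃ V : Submodule ℝ (Set.Icc (-T) T × Real.Angle → ℝ),
      FiniteDimensional ℝ V ∧ Delaunay.jacobiKer a α T = V) ∧
    {T : ℝ | 0 < T ∧ Delaunay.jacobiKer a α T ≠ {0}}.Countable ∧
    (a < 0 → ∀ T : ℝ, 0 < T →
      (Delaunay.jacobiKer a α T ≠ {0} ↔ T ∈ Delaunay.nodalTimes a 0) ∧
      (T ∈ Delaunay.nodalTimes a 0 →
        Delaunay.jacobiKer a α T =
          Submodule.span ℝ {fun p : Set.Icc (-T) T × Real.Angle => Delaunay.wa a 0 p.1})) ∧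
    (0 < a → a ≤ (Real.sqrt 3 - 1) / 2 → ∀ T : ℝ, 0 < T →
      (Delaunay.jacobiKer a α T ≠ {0} ↔
        T ∈ Delaunay.nodalTimes a 0 ∪ Delaunay.nodalTimes a 1) ∧
      (T ∈ Delaunay.nodalTimes a 0 →
        Delaunay.jacobiKer a α T =
          Submodule.span ℝ {fun p : Set.Icc (-T) T × Real.Angle => Delaunay.wa a 0 p.1}) ∧
      (T ∈ Delaunay.nodalTimes a 1 →
        Delaunay.jacobiKer a α T =
          Submodule.span ℝ {fun p : Set.Icc (-T) T × Real.Angle => Delaunay.wa a 1 p.1 * p.2.cos,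
            fun p => Delaunay.wa a 1 p.1 * p.2.sin})) := by
  have hw0 := isEvenSol_wa_zero ha
  have hw1 := isEvenSol_wa_one ha
  -- both functions are nonzero at the point `(0, 0)`
  have hne0 : ∀ T : ℝ, 0 < T → wa a 0 T = 0 → jacobiKer a α T ≠ {0} := fun T hT h =>
    jacobiKer_ne_zero_of_mem (wa_zero_mem ha hα1.le hT h)
      (p := (⟨0, by linarith, hT.le⟩, 0)) (by simp [hw0.zero])
  have hne1 : ∀ T : ℝ, 0 < T → wa a 1 T = 0 → jacobiKer a α T ≠ {0} := fun T hT h =>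
    jacobiKer_ne_zero_of_mem (wa_one_cos_mem ha hα1.le hT h)
      (p := (⟨0, by linarith, hT.le⟩, 0)) (by simp [hw1.zero])
  have hmid : ∀ T : ℝ, 0 < T → (0 : ℝ) ∈ Icc (-T) T := fun T hT => ⟨by linarith, hT.le⟩
  refine ⟨fun T hT => ⟨kerSubmodule ha α hT, finiteDimensional_kerSubmodule ha α hT, rfl⟩,
    countable_jacobiKer_ne ha α, fun hneg T hT => ?_, fun hpos hle T hT => ?_⟩
  · have ha' : a ∈ Ioo (-1) 0 := ha.resolve_right fun h => hneg.not_gt h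
    have hkill : ∀ j f g, j ≠ 0 → IsMode a j T f g → f 0 = 0 := fun j f g hj hfg =>
      hfg.eq_zero_of_neg ha' hT (Nat.one_le_iff_ne_zero.2 hj) 0 (hmid T hT)
    rw [mem_nodalTimes_iff ha hw0]
    refine ⟨⟨fun hker => ⟨hT, ?_⟩, fun h => hne0 T hT h.2⟩,
      fun h => jacobiKer_eq_span_zero ha hα1.le hT hkill h.2⟩
    by_contra hwT
    refine hker (jacobiKer_eq_zero ha hT fun j f g hfg => ?_)
    rcases eq_or_ne j 0 with rfl | hj
    · exact hfg.apply_zero_eq_zero ha hT hw0 hwT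
    · exact hkill j f g hj hfg
  · -- the bound on `a` says that `γ ≤ 1 / 2`, so that `2 p_a ≤ 4`
    have hkill : ∀ j f g, j ≠ 0 → j ≠ 1 → IsMode a j T f g → f 0 = 0 :=
      fun j f g hj0 hj1 hfg => by
        refine hfg.eq_zero_of_le ha hT ?_ 0 (hmid T hT)
        have h3 := Real.sq_sqrt (show (0 : ℝ) ≤ 3 by norm_num)
        have hg : gam a ≤ 1 / 2 := by
          rw [gam]
          nlinarith [Real.sqrt_nonneg 3]
        have hj : 2 ≤ j := by omega
        have hj' : (2 : ℝ) ≤ j := by exact_mod_cast hj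
        nlinarith
    rw [mem_union, mem_nodalTimes_iff ha hw0, mem_nodalTimes_iff ha hw1]
    refine ⟨⟨fun hker => ?_, ?_⟩, fun h => ?_, fun h => ?_⟩
    · by_contra hn
      push Not at hn
      refine hker (jacobiKer_eq_zero ha hT fun j f g hfg => ?_)
      rcases eq_or_ne j 0 with rfl | hj0
      · exact hfg.apply_zero_eq_zero ha hT hw0 (hn.1 hT)
      rcases eq_or_ne j 1 with rfl | hj1
      · exact hfg.apply_zero_eq_zero ha hT hw1 (hn.2 hT)
      exact hkill j f g hj0 hj1 hfg
    · rintro (h | h)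
      · exact hne0 T hT h.2
      · exact hne1 T hT h.2
    · refine jacobiKer_eq_span_zero ha hα1.le hT (fun j f g hj hfg => ?_) h.2
      rcases eq_or_ne j 1 with rfl | hj1
      · exact hfg.apply_zero_eq_zero ha hT hw1 (wa_one_ne_zero hpos hT h.2)
      · exact hkill j f g hj hj1 hfg
    · refine jacobiKer_eq_span_one ha hα1.le hT (fun j f g hj hfg => ?_) h.2
      rcases eq_or_ne j 0 with rfl | hj0
      · exact hfg.apply_zero_eq_zero ha hT hw0 fun h0 => wa_one_ne_zero hpos hT h0 h.2
      · exact hkill j f g hj0 hj hfg
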